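/- Let $m\ge 2$ and let $T$ be a triangulation of a regular $m$-gon with vertices numbered $1,\dots,m$ counterclockwise, i.e. a maximal set of pairwise non-crossing diagonals (for $m\in\{2,3\}$ there are no diagonals, and $T$ has $m-2$ triangles). A labelling of $T$ assigns an integer $a_t$ to each triangle $t$ of $T$. It is called admissible if (i) the set of triangles $t$ with $a_t\notin\{1,-1\}$ is a disjoint union of two-element sets $\{t_1,t_2\}$, called squares, such that $t_1$ and $t_2$ have a common edge and $a_{t_1}=-a_{t_2}$; and (ii) the number of negative labels plus half the number of labels $0$ is an even integer. Let an admissible labelling of $T$ be given, together with any choice of squares as in (i). Below, vertex indices are read modulo $m$; $(k-1,k,k+1)$ denotes the triangle with these vertices; and "$(k-1,k,k+1,k+2)$ is a square labelled $(c,-c)$" means that these are the vertices of one of the chosen squares, whose two triangles have labels $c$ and $-c$. Removing the triangle $(k-1,k,k+1)$ also removes the vertex $k$, and removing the square $(k-1,k,k+1,k+2)$ also removes the vertices $k,k+1$; the remaining vertices, in their order, are the vertices of the smaller polygon, and the remaining triangles are the triangles of its triangulation. Then at least one of the following holds: (0) $m<4$, and $T$ has either no triangle, or exactly one triangle and its label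 is $1$. (1) There is an index $k$ such that $(k-1,k,k+1)$ is a triangle of $T$ labelled $1$, and removing this triangle yields an admissible labelling of a triangulation of an $(m-1)$-gon. (2) $m$ is odd and there is an index $k$ such that $(k-1,k,k+1,k+2)$ is a square labelled $(c,-c)$ for some $c$, and removing this square and multiplying all remaining labels by $-1$ yields an admissible labelling of a triangulation of an $(m-2)$-gon. (3) $m$ is even and there is an index $k$ such that $(k-1,k,k+1)$ is a triangle of $T$ labelled $-1$, and removing this triangle and multiplying all remaining labels by $-1$ yields an admissible labelling of a triangulation of an $(m-1)$-gon. (4) There are indices $j,k\in\{1,\dots,m\}$ with $|j-k|>1$ such that $(j-1,j,j+1,j+2)$ and $(k-1,k,k+1,k+2)$ are two different squares labelled $(c,-c)$ and $(d,-d)$ for some $c,d$, and removing these two squares yields an admissible labelling of a triangulation of an $(m-4)$-gon. (5) There are indices $j,k\in\{1,\dots,m\}$ with $|j-k|>1$ such that $(j-1,j,j+1)$ and $(k-1,k,k+1)$ are triangles of $T$ labelled $-1$, and removing these two triangles yields an admissible labelling of a triangulation of an $(m-2)$-gon. -/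

import Mathlib

/-! The vertices of the `m`-gon are the elements `0, 1, …, m - 1` of `Fin m`, in counterclockwise
order; indices are read cyclically, so `finRotate m k` is `k + 1` and `(finRotate m).symm k` is
`k - 1`. A chord is recorded as the pair `(i, j)` of its end points with `i < j`. -/

namespace LabelledPolygon

/-- For `i < j`: the chord from `i` to `j` is a side of the `m`-gon. -/
def IsSide {m : ℕ} (i j : Fin m) : Prop :=
  j.val = i.val + 1 ∨ (i.val = 0 ∧ j.val + 1 = m)

instance {m : ℕ} (i j : Fin m) : Decidable (IsSide i j) := by
  unfold IsSide
  infer_instance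

/-- The pair `(i, j)`, with `i < j`, is a diagonal of the `m`-gon. -/
def IsDiagonal {m : ℕ} (d : Fin m × Fin m) : Prop :=
  d.1 < d.2 ∧ ¬ IsSide d.1 d.2

/-- Two diagonals cross (meet in an interior point of both). -/
def Cross {m : ℕ} (d d' : Fin m × Fin m) : Prop :=
  (d.1 < d'.1 ∧ d'.1 < d.2 ∧ d.2 < d'.2) ∨ (d'.1 < d.1 ∧ d.1 < d'.2 ∧ d'.2 < d.2)

/-- A triangulation of the (regular) `m`-gon, `m ≥ 2`: a maximal set of pairwise non-crossing
diagonals. -/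
structure Triangulation (m : ℕ) where
  two_le : 2 ≤ m
  diagonals : Finset (Fin m × Fin m)
  isDiagonal : ∀ d ∈ diagonals, IsDiagonal d
  not_cross : ∀ d ∈ diagonals, ∀ d' ∈ diagonals, ¬ Cross d d'
  maximal : ∀ d : Fin m × Fin m, IsDiagonal d → (∀ d' ∈ diagonals, ¬ Cross d d') → d ∈ diagonals

namespace Triangulation

/-- The triangles of `T`, as sets of three vertices: any two of the vertices are joined by a side
of the polygon or by a diagonal of `T`. -/
def triangles {m : ℕ} (T : Triangulation m) : Finset (Finset (Fin m)) :=
  Finset.univ.filter fun t =>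
    t.card = 3 ∧ ∀ i ∈ t, ∀ j ∈ t, i < j → (IsSide i j ∨ (i, j) ∈ T.diagonals)

/-- The type of triangles of `T`. -/
abbrev Triangle {m : ℕ} (T : Triangulation m) : Type :=
  {t : Finset (Fin m) // t ∈ T.triangles}

/-- A labelling assigns an integer to each triangle. -/
abbrev Labelling {m : ℕ} (T : Triangulation m) : Type :=
  T.Triangle → ℤ

/-- Distinct triangles with a common edge. -/
def Neighbouring {m : ℕ} {T : Triangulation m} (t₁ t₂ : T.Triangle) : Prop :=
  t₁ ≠ t₂ ∧ (t₁.1 ∩ t₂.1).card = 2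

/-- `P` is a choice of squares for the labelling `a`: a family of pairwise disjoint two-element sets
of neighbouring triangles with opposite labels, whose union is the set of all triangles with label
different from `1` and `-1`. -/
def IsSquarePartition {m : ℕ} (T : Triangulation m) (a : T.Labelling)
    (P : Finset (Finset T.Triangle)) : Prop :=
  (∀ s ∈ P, ∃ t₁ t₂ : T.Triangle, s = {t₁, t₂} ∧ Neighbouring t₁ t₂ ∧ a t₁ = - a t₂) ∧
  (∀ s ∈ P, ∀ s' ∈ P, s ≠ s' → Disjoint s s') ∧
  (∀ t : T.Triangle, (∃ s ∈ P, t ∈ s) ↔ (a t ≠ 1 ∧ a t ≠ -1))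

/-- The number of negative labels plus half the number of labels `0`. The sign of the labelling is
`(-1)` to this power, if it is an integer. -/
def signExponent {m : ℕ} (T : Triangulation m) (a : T.Labelling) : ℚ :=
  ((Finset.univ.filter fun t : T.Triangle => a t < 0).card : ℚ) +
    ((Finset.univ.filter fun t : T.Triangle => a t = 0).card : ℚ) / 2

/-- Admissible labellings. -/
def Admissible {m : ℕ} (T : Triangulation m) (a : T.Labelling) : Prop :=
  (∃ P : Finset (Finset T.Triangle), T.IsSquarePartition a P) ∧
  (∃ n : ℕ, Even n ∧ T.signExponent a = n)

/-- The triangle `t` is `(k-1, k, k+1)`. -/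
def IsEarTriangle {m : ℕ} (T : Triangulation m) (t : T.Triangle) (k : Fin m) : Prop :=
  t.1 = {(finRotate m).symm k, k, finRotate m k}

/-- The two-element set `s` of triangles is the square `(k-1, k, k+1, k+2)` labelled `(c, -c)`. -/
def IsBoundarySquare {m : ℕ} (T : Triangulation m) (a : T.Labelling) (s : Finset T.Triangle)
    (k : Fin m) (c : ℤ) : Prop :=
  ∃ t₁ t₂ : T.Triangle, s = {t₁, t₂} ∧ Neighbouring t₁ t₂ ∧
    t₁.1 ∪ t₂.1 = {(finRotate m).symm k, k, finRotate m k, finRotate m (finRotate m k)} ∧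
    a t₁ = c ∧ a t₂ = -c

/-- Removing the triangles in `R`, and with them the vertices in `S`, and multiplying all remaining
labels by `ε` yields an admissible labelling `a'` of a triangulation `T'` of an `m'`-gon: the
vertices of the `m'`-gon are, in their order, the vertices outside `S`, and the triangles of `T'`
are exactly the triangles of `T` outside `R`. -/
def RemovalAdmissible {m : ℕ} (T : Triangulation m) (a : T.Labelling)
    (R : Finset T.Triangle) (S : Finset (Fin m)) (ε : ℤ) (m' : ℕ) : Prop :=
  ∃ (T' : Triangulation m') (a' : T'.Labelling) (e : Fin m' ↪o Fin m),
    (∀ v : Fin m, (∃ w : Fin m', e w = v) ↔ v ∉ S) ∧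
    (∀ t : T.Triangle, t ∉ R → ∃ t' : T'.Triangle, t'.1.map e.toEmbedding = t.1) ∧
    (∀ t' : T'.Triangle, ∃ t : T.Triangle,
      t ∉ R ∧ t'.1.map e.toEmbedding = t.1 ∧ a' t' = ε * a t) ∧
    T'.Admissible a'

end Triangulation

end LabelledPolygon

/-! Let `p` and `n` be the numbers of labels `1` and `-1`, and `s` the number of squares. A square
contributes exactly `1` to the sign exponent, whatever its label `c`, so admissibility says that `n
+ s` is even. Counting triangles gives `p + n + 2 * s = m - 2`, so `p + s` has the parity of `m`.

Glue the two triangles of each square. The dual graph becomes a tree whose nodes are the triangles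
labelled `1` or `-1` and the squares. If there are at least two nodes, there are two leaves, which
are ears or boundary squares (`exists_two_leaves`). Removing leaves, possibly with negation, only
changes these counts: a leaf labelled `1` can always be removed; a leaf labelled `-1` can be removed
with negation if `p + s` is even, that is, if `m` is even; a square leaf can be removed with
negation if `p + s - 1` is even, that is, if `m` is odd. If none of these applies, both leaves are
labelled `-1` (`m` odd) or both are squares (`m` even), and removing both lowers `n + s` by `2`. A
single node must be a triangle labelled `1`, since otherwise `n + s = 1`.

The tree is handled through edges: cutting along an edge of `T` leaves a triangulation
(`Cut.exists_isDeletion`), `IsNodeEdge.exists_node` finds the node below an edge, and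
`IsDeletion.removalAdmissible` reduces admissibility after a removal to the parity count. -/

namespace LabelledPolygon

/-! ### Edges, triangles and their middle vertices -/

namespace Triangulation

/-- The chord from `i` to `j`, with `i < j`, is a side of the polygon or a diagonal of `T`. -/
def Edge {m : ℕ} (T : Triangulation m) (i j : Fin m) : Prop :=
  i < j ∧ (IsSide i j ∨ (i, j) ∈ T.diagonals)

variable {m : ℕ} {T : Triangulation m}

theorem Edge.not_cross {i j u v : Fin m} (h : T.Edge i j) (h' : T.Edge u v) :
    ¬ (i < u ∧ u < j ∧ j < v) := by
  rintro ⟨h1, h2, h3⟩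
  obtain ⟨-, h | h⟩ := h
  · unfold IsSide at h
    have := v.isLt
    omega
  · obtain ⟨-, h' | h'⟩ := h'
    · unfold IsSide at h'
      have := v.isLt
      omega
    · exact T.not_cross _ h _ h' (Or.inl ⟨h1, h2, h3⟩)

theorem edge_of_not_cross {i j : Fin m} (hij : i < j)
    (h : ∀ u v, T.Edge u v → ¬ Cross (i, j) (u, v)) : T.Edge i j := by
  refine ⟨hij, ?_⟩
  by_cases hs : IsSide i j
  · exact Or.inl hs
  · exact Or.inr (T.maximal _ ⟨hij, hs⟩ fun d hd =>
      h d.1 d.2 ⟨(T.isDiagonal d hd).1, Or.inr hd⟩)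

theorem edge_of_isSide {i j : Fin m} (hij : i < j) (h : IsSide i j) : T.Edge i j :=
  ⟨hij, Or.inl h⟩

/-- Every edge that spans at least one further vertex has a triangle below it. -/
theorem Edge.exists_apex {i j : Fin m} (h : T.Edge i j) (hij : i.val + 1 < j.val) :
    ∃ x, i < x ∧ x < j ∧ T.Edge i x ∧ T.Edge x j := by
  classical
  have hj := j.isLt
  -- The apex is the last vertex before `j` joined to `i`. An edge crossing the chord from it to `j`
  -- would cross `(i, j)` or `(i, x)`, or would join `i` to a later vertex.
  let A : Finset (Fin m) := Finset.univ.filter fun x => x < j ∧ T.Edge i x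
  have hA : A.Nonempty := by
    refine ⟨⟨i.val + 1, by omega⟩, ?_⟩
    simp only [A, Finset.mem_filter, Finset.mem_univ, true_and]
    exact ⟨hij, edge_of_isSide (Fin.lt_def.2 (by simp)) (Or.inl rfl)⟩
  obtain ⟨x, hxA, hmax⟩ := A.exists_max_image id hA
  simp only [A, Finset.mem_filter, Finset.mem_univ, true_and, id] at hxA hmax
  obtain ⟨hxj, hix⟩ := hxA
  refine ⟨x, hix.1, hxj, hix, edge_of_not_cross hxj ?_⟩
  rintro u v huv (⟨h1, h2, h3⟩ | ⟨h1, h2, h3⟩)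
  · exact h.not_cross huv ⟨hix.1.trans h1, h2, h3⟩
  · simp only at h1 h2 h3
    rcases lt_trichotomy u i with hu | hu | hu
    · exact huv.not_cross h ⟨hu, hix.1.trans h2, h3⟩
    · subst hu
      exact absurd (hmax v ⟨h3, huv⟩) (not_le.2 h2)
    · exact hix.not_cross huv ⟨hu, h1, h2⟩

theorem mem_triangles_iff {t : Finset (Fin m)} :
    t ∈ T.triangles ↔ ∃ i x j, t = {i, x, j} ∧ T.Edge i x ∧ T.Edge x j ∧ T.Edge i j := by
  simp only [triangles, Finset.mem_filter, Finset.mem_univ, true_and]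
  constructor
  · rintro ⟨hc, h⟩
    obtain ⟨x, y, z, hxy, hxz, hyz, rfl⟩ := Finset.card_eq_three.1 hc
    have key : ∀ u v w : Fin m, u < v → v < w → ({x, y, z} : Finset (Fin m)) = {u, v, w} →
        ∃ i x' j, ({x, y, z} : Finset (Fin m)) = {i, x', j} ∧
          T.Edge i x' ∧ T.Edge x' j ∧ T.Edge i j := by
      intro u v w huv hvw he
      rw [he] at h ⊢
      exact ⟨u, v, w, rfl, ⟨huv, h u (by simp) v (by simp) huv⟩,
        ⟨hvw, h v (by simp) w (by simp) hvw⟩,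
        ⟨huv.trans hvw, h u (by simp) w (by simp) (huv.trans hvw)⟩⟩
    rcases lt_or_gt_of_ne hxy with h1 | h1 <;> rcases lt_or_gt_of_ne hxz with h2 | h2 <;>
      rcases lt_or_gt_of_ne hyz with h3 | h3
    · exact key x y z h1 h3 rfl
    · exact key x z y h2 h3 (by ext; simp; tauto)
    · omega
    · exact key z x y h2 h1 (by ext; simp; tauto)
    · exact key y x z h1 h2 (by ext; simp; tauto)
    · omega
    · exact key y z x h3 h2 (by ext; simp; tauto)
    · exact key z y x h3 h1 (by ext; simp; tauto)
  · rintro ⟨i, x, j, rfl, h1, h2, h3⟩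
    refine ⟨Finset.card_eq_three.2 ⟨i, x, j, h1.1.ne, h3.1.ne, h2.1.ne, rfl⟩, ?_⟩
    intro u hu v hv huv
    simp only [Finset.mem_insert, Finset.mem_singleton] at hu hv
    have := h1.1
    have := h2.1
    rcases hu with rfl | rfl | rfl <;> rcases hv with rfl | rfl | rfl <;>
      first | (exfalso; omega) | exact h1.2 | exact h2.2 | exact h3.2

/-- The vertices `i < x < j` form a triangle of `T`. -/
def IsTriple (T : Triangulation m) (i x j : Fin m) : Prop :=
  T.Edge i x ∧ T.Edge x j ∧ T.Edge i j

theorem Triangle.exists_triple (t : T.Triangle) : ∃ i x j, t.1 = {i, x, j} ∧ T.IsTriple i x j :=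
  mem_triangles_iff.1 t.2

/-- The triangle with given vertices. -/
def IsTriple.triangle {i x j : Fin m} (h : T.IsTriple i x j) : T.Triangle :=
  ⟨{i, x, j}, mem_triangles_iff.2 ⟨i, x, j, rfl, h⟩⟩

/-- If `i < i'`, then `(i, x)` would cross `(i', j')`; the other inequalities are excluded in the
same way. Triangles can therefore be identified and counted by their middle vertices. -/
theorem IsTriple.eq_of_mid_eq {i x j i' j' : Fin m} (h : T.IsTriple i x j)
    (h' : T.IsTriple i' x j') : i = i' ∧ j = j' := by
  have a1 := h.1.not_cross h'.2.2
  have a2 := h'.1.not_cross h.2.2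
  have a3 := h.2.2.not_cross h'.2.1
  have a4 := h'.2.2.not_cross h.2.1
  have := h.1.1
  have := h.2.1.1
  have := h'.1.1
  have := h'.2.1.1
  constructor <;> omega

/-- A shortest edge passing strictly over `x` has its apex at `x`, since any other apex would give a
shorter edge over `x`. -/
theorem exists_triple_of_mid {x : Fin m} (h0 : 0 < x.val) (h1 : x.val + 1 < m) :
    ∃ i j, T.IsTriple i x j := by
  classical
  let A : Finset (Fin m × Fin m) :=
    Finset.univ.filter fun p => T.Edge p.1 p.2 ∧ p.1 < x ∧ x < p.2
  have hA : A.Nonempty := by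
    refine ⟨(⟨0, by omega⟩, ⟨m - 1, by omega⟩), ?_⟩
    simp only [A, Finset.mem_filter, Finset.mem_univ, true_and]
    refine ⟨edge_of_isSide ?_ (Or.inr ⟨rfl, ?_⟩), ?_, ?_⟩ <;> simp only [Fin.lt_def] <;> omega
  obtain ⟨⟨i, j⟩, hm, hmin⟩ := A.exists_min_image (fun p => p.2.val - p.1.val) hA
  simp only [A, Finset.mem_filter, Finset.mem_univ, true_and, Prod.forall] at hm hmin
  obtain ⟨hij, hix, hxj⟩ := hm
  obtain ⟨y, hiy, hyj, e1, e2⟩ := hij.exists_apex (by omega)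
  have hy : y = x := by
    rcases lt_trichotomy x y with h | h | h
    · have := hmin i y ⟨e1, hix, h⟩
      omega
    · exact h.symm
    · have := hmin y j ⟨e2, h, hxj⟩
      omega
  subst hy
  exact ⟨i, j, e1, e2, hij⟩

/-- The middle vertex of a triangle. -/
noncomputable def Triangle.mid (t : T.Triangle) : Fin m :=
  t.exists_triple.choose_spec.choose

theorem Triangle.exists_eq (t : T.Triangle) : ∃ i j, t.1 = {i, t.mid, j} ∧ T.IsTriple i t.mid j :=
  ⟨_, t.exists_triple.choose_spec.choose_spec⟩

theorem Triangle.mid_injective : Function.Injective (Triangle.mid (T := T)) := by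
  intro t t' h
  obtain ⟨i, j, e, ht⟩ := t.exists_eq
  obtain ⟨i', j', e', ht'⟩ := t'.exists_eq
  rw [h] at ht
  obtain ⟨rfl, rfl⟩ := ht.eq_of_mid_eq ht'
  exact Subtype.ext (by rw [e, e', h])

theorem Triangle.mid_pos (t : T.Triangle) : 0 < t.mid.val ∧ t.mid.val + 1 < m := by
  obtain ⟨i, j, -, h1, h2, -⟩ := t.exists_eq
  have := h1.1
  have := h2.1
  omega

theorem IsTriple.mid_triangle {i x j : Fin m} (h : T.IsTriple i x j) : h.triangle.mid = x := by
  obtain ⟨i', j', e, h'⟩ := h.triangle.exists_eq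
  have e' : ({i, x, j} : Finset (Fin m)) = {i', h.triangle.mid, j'} := e
  have h1 := h.1.1
  have h2 := h.2.1.1
  have h3 := h'.1.1
  have h4 := h'.2.1.1
  have a1 : x ∈ ({i', h.triangle.mid, j'} : Finset (Fin m)) := by rw [← e']; simp
  have a2 : i ∈ ({i', h.triangle.mid, j'} : Finset (Fin m)) := by rw [← e']; simp
  have a3 : j ∈ ({i', h.triangle.mid, j'} : Finset (Fin m)) := by rw [← e']; simp
  simp only [Finset.mem_insert, Finset.mem_singleton] at a1 a2 a3
  omega

/-- A triangulation of an `m`-gon has `m - 2` triangles. -/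
theorem card_triangle : Fintype.card T.Triangle = m - 2 := by
  classical
  have hm := T.two_le
  -- The middle vertices are exactly the vertices other than the first and the last.
  have : (Finset.univ.image (Triangle.mid (T := T))) =
      Finset.univ.filter fun x : Fin m => 0 < x.val ∧ x.val + 1 < m := by
    ext x
    simp only [Finset.mem_image, Finset.mem_univ, true_and, Finset.mem_filter]
    constructor
    · rintro ⟨t, rfl⟩
      exact t.mid_pos
    · rintro ⟨h0, h1⟩
      obtain ⟨i, j, h⟩ := exists_triple_of_mid (T := T) h0 h1
      exact ⟨h.triangle, h.mid_triangle⟩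
  rw [← Finset.card_univ, ← Finset.card_image_of_injective _ Triangle.mid_injective, this]
  rw [← Finset.card_map Fin.valEmbedding]
  have : (Finset.univ.filter fun x : Fin m => 0 < x.val ∧ x.val + 1 < m).map Fin.valEmbedding =
      Finset.Ioo 0 (m - 1) := by
    ext x
    simp only [Finset.mem_map, Finset.mem_filter, Finset.mem_univ, true_and, Fin.valEmbedding_apply,
      Finset.mem_Ioo]
    constructor
    · rintro ⟨y, hy, rfl⟩
      omega
    · intro hx
      exact ⟨⟨x, by omega⟩, by simp only; omega, rfl⟩
  rw [this, Nat.card_Ioo]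
  omega

end Triangulation

end LabelledPolygon

/-! ### Deleting vertices from a triangulation -/

namespace LabelledPolygon

namespace Triangulation

/-- `T'` is obtained from `T` by deleting the vertices in `S`; the remaining vertices, in their
order, are enumerated by `e`. -/
structure IsDeletion {m m' : ℕ} (T : Triangulation m) (S : Finset (Fin m)) (T' : Triangulation m')
    (e : Fin m' ↪o Fin m) : Prop where
  range : ∀ v, (∃ w, e w = v) ↔ v ∉ S
  edge : ∀ u v, T'.Edge u v ↔ T.Edge (e u) (e v)

variable {m : ℕ} {T : Triangulation m}

/-- The surviving edges form a maximal family as soon as no edge with a deleted end crosses a chord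
between survivors (`hsep`), and the sides of the smaller polygon are edges of `T` (`hside`). -/
theorem exists_isDeletion {S : Finset (Fin m)} (hcard : 2 ≤ Sᶜ.card)
    (hsep : ∀ u v, T.Edge u v → (u ∈ S ∨ v ∈ S) → ∀ p q, p ∉ S → q ∉ S → p < q →
      ¬ Cross (p, q) (u, v))
    (hside : ∀ p q, p ∉ S → q ∉ S → p < q →
      ((∀ w, p < w → w < q → w ∈ S) ∨ (∀ w, w < p ∨ q < w → w ∈ S)) → T.Edge p q) :
    ∃ (m' : ℕ) (T' : Triangulation m') (e : Fin m' ↪o Fin m), T.IsDeletion S T' e := by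
  classical
  let e : Fin Sᶜ.card ↪o Fin m := Sᶜ.orderEmbOfFin rfl
  have hrange : ∀ v, (∃ w, e w = v) ↔ v ∉ S := by
    intro v
    rw [← Set.mem_range, Finset.range_orderEmbOfFin]
    simp
  have hS : ∀ w, e w ∉ S := fun w => (hrange _).1 ⟨w, rfl⟩
  have hsideE : ∀ u v, u < v → IsSide u v → T.Edge (e u) (e v) := by
    intro u v huv h
    refine hside _ _ (hS u) (hS v) (e.lt_iff_lt.2 huv) ?_
    rcases h with h | ⟨h, h'⟩
    · left
      intro w h1 h2
      by_contra hw
      obtain ⟨w, rfl⟩ := (hrange w).2 hw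
      rw [e.lt_iff_lt] at h1 h2
      omega
    · right
      intro w hw'
      by_contra hw
      obtain ⟨w, rfl⟩ := (hrange w).2 hw
      rw [e.lt_iff_lt, e.lt_iff_lt] at hw'
      have := w.isLt
      omega
  let T' : Triangulation Sᶜ.card :=
    { two_le := hcard
      diagonals := Finset.univ.filter fun d => IsDiagonal d ∧ T.Edge (e d.1) (e d.2)
      isDiagonal := fun d hd => (Finset.mem_filter.1 hd).2.1
      not_cross := by
        intro d hd d' hd'
        have h := (Finset.mem_filter.1 hd).2.2
        have h' := (Finset.mem_filter.1 hd').2.2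
        have a := h.not_cross h'
        have b := h'.not_cross h
        simp only [e.lt_iff_lt] at a b
        rintro (hc | hc)
        exacts [a hc, b hc]
      maximal := by
        intro d hd hc
        refine Finset.mem_filter.2 ⟨Finset.mem_univ _, hd, ?_⟩
        refine edge_of_not_cross (e.lt_iff_lt.2 hd.1) fun u v huv hx => ?_
        -- An edge crossing the new chord either has a deleted end, or comes from a side of the
        -- smaller polygon, which crosses nothing, or from a diagonal of `T'`.
        by_cases huS : u ∈ S ∨ v ∈ S
        · exact hsep u v huv huS _ _ (hS _) (hS _) (e.lt_iff_lt.2 hd.1) hx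
        · rw [not_or] at huS
          obtain ⟨u, rfl⟩ := (hrange u).2 huS.1
          obtain ⟨v, rfl⟩ := (hrange v).2 huS.2
          have huv' : u < v := e.lt_iff_lt.1 huv.1
          simp only [Cross, e.lt_iff_lt] at hx
          by_cases hs : IsSide u v
          · unfold IsSide at hs
            have := d.1.isLt
            have := d.2.isLt
            omega
          · exact hc (u, v) (Finset.mem_filter.2 ⟨Finset.mem_univ _, ⟨huv', hs⟩, huv⟩) hx }
  refine ⟨Sᶜ.card, T', e, hrange, fun u v => ⟨?_, ?_⟩⟩
  · rintro ⟨huv, h | h⟩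
    · exact hsideE u v huv h
    · exact (Finset.mem_filter.1 h).2.2
  · intro h
    have huv : u < v := e.lt_iff_lt.1 h.1
    refine ⟨huv, ?_⟩
    by_cases hs : IsSide u v
    · exact Or.inl hs
    · exact Or.inr (Finset.mem_filter.2 ⟨Finset.mem_univ _, ⟨huv, hs⟩, h⟩)

/-- The vertices in `S` are those strictly on one side of an edge of `T`. -/
def Cut (T : Triangulation m) (S : Finset (Fin m)) : Prop :=
  ∃ i j, T.Edge i j ∧ (S = Finset.Ioo i j ∨ S = (Finset.Icc i j)ᶜ)

/-- No edge crosses `(i, j)`, so an edge with an end in `S` stays on that side and crosses no chord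
between survivors. The only side of the smaller polygon that need not be an old side is `(i, j)`
itself. -/
theorem Cut.exists_isDeletion {S : Finset (Fin m)} (h : T.Cut S) :
    ∃ (m' : ℕ) (T' : Triangulation m') (e : Fin m' ↪o Fin m), T.IsDeletion S T' e := by
  obtain ⟨i, j, hij, hS⟩ := h
  have hlt := hij.1
  have hi : i ∉ S := by rcases hS with rfl | rfl <;> simp [hlt.le]
  have hj : j ∉ S := by rcases hS with rfl | rfl <;> simp [hlt.le]
  apply Triangulation.exists_isDeletion
  · have : ({i, j} : Finset (Fin m)) ⊆ Sᶜ := by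
      intro x hx
      simp only [Finset.mem_insert, Finset.mem_singleton] at hx
      rcases hx with rfl | rfl <;> simpa
    calc 2 = ({i, j} : Finset (Fin m)).card := (Finset.card_pair hlt.ne).symm
      _ ≤ _ := Finset.card_le_card this
  · intro u v huv hS' p q hp hq hpq hx
    have := hij.not_cross huv
    have := huv.not_cross hij
    have := huv.1
    unfold Cross at hx
    simp only at hx
    rcases hS with rfl | rfl <;> simp only [Finset.mem_Ioo, Finset.mem_compl, Finset.mem_Icc] at * <;>
      omega
  · intro p q hp hq hpq h
    have hlast := q.isLt
    rcases hS with rfl | rfl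
    · simp only [Finset.mem_Ioo] at *
      rcases h with h | h
      · by_cases hs : q.val = p.val + 1
        · exact edge_of_isSide hpq (Or.inl hs)
        · have h1 := h ⟨p.val + 1, by omega⟩ (Fin.lt_def.2 (by simp))
            (Fin.lt_def.2 (by simp only; omega))
          have h2 := h ⟨q.val - 1, by omega⟩ (Fin.lt_def.2 (by simp only; omega))
            (Fin.lt_def.2 (by simp only; omega))
          simp only [Fin.lt_def] at *
          have e1 : p = i := by omega
          have e2 : q = j := by omega
          rwa [e1, e2]
      · refine edge_of_isSide hpq (Or.inr ⟨?_, ?_⟩)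
        · by_contra h0
          have := h ⟨0, by omega⟩ (Or.inl (Fin.lt_def.2 (by simp only; omega)))
          simp only [Fin.lt_def] at this
          omega
        · by_contra h0
          have := h ⟨m - 1, by omega⟩ (Or.inr (Fin.lt_def.2 (by simp only; omega)))
          simp only [Fin.lt_def] at this
          omega
    · simp only [Finset.mem_compl, Finset.mem_Icc, not_not] at *
      rcases h with h | h
      · refine edge_of_isSide hpq (Or.inl ?_)
        by_contra hs
        have := h ⟨p.val + 1, by omega⟩ (Fin.lt_def.2 (by simp))
            (Fin.lt_def.2 (by simp only; omega))
        simp only [Fin.le_def, Fin.lt_def] at *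
        omega
      · have h1 := h i
        have h2 := h j
        have e1 : p = i := by omega
        have e2 : q = j := by omega
        rwa [e1, e2]

theorem IsDeletion.trans {m₁ m₂ : ℕ} {T₁ : Triangulation m₁} {T₂ : Triangulation m₂}
    {e₁ : Fin m₁ ↪o Fin m} {e₂ : Fin m₂ ↪o Fin m₁} {S₁ : Finset (Fin m)} {S₂ : Finset (Fin m₁)}
    (h₁ : T.IsDeletion S₁ T₁ e₁) (h₂ : T₁.IsDeletion S₂ T₂ e₂) :
    T.IsDeletion (S₁ ∪ S₂.map e₁.toEmbedding) T₂ (e₂.trans e₁) := by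
  refine ⟨fun v => ?_, fun u v => (h₂.edge u v).trans (h₁.edge _ _)⟩
  simp only [RelEmbedding.coe_trans, Function.comp_apply, Finset.mem_union, Finset.mem_map,
    RelEmbedding.coe_toEmbedding, not_or, not_exists, not_and]
  constructor
  · rintro ⟨w, rfl⟩
    refine ⟨(h₁.range _).1 ⟨_, rfl⟩, fun x hx hxe => ?_⟩
    rw [e₁.injective hxe] at hx
    exact (h₂.range _).1 ⟨w, rfl⟩ hx
  · rintro ⟨h, h'⟩
    obtain ⟨w, rfl⟩ := (h₁.range v).2 h
    obtain ⟨w, rfl⟩ := (h₂.range w).2 fun hw => h' w hw rfl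
    exact ⟨w, rfl⟩

/-- Since `S` avoids the closed interval, `i` and `j` survive the first deletion, and `(i, j)` is
still an edge along which to cut a second time. -/
theorem Cut.exists_isDeletion_union {S : Finset (Fin m)} (h : T.Cut S) {i j : Fin m}
    (hij : T.Edge i j) (hd : Disjoint S (Finset.Icc i j)) :
    ∃ (m' : ℕ) (T' : Triangulation m') (e : Fin m' ↪o Fin m),
      T.IsDeletion (S ∪ Finset.Ioo i j) T' e := by
  obtain ⟨m₁, T₁, e₁, h₁⟩ := h.exists_isDeletion
  have hS : ∀ x, x ∈ Finset.Icc i j → x ∉ S := fun x hx hx' =>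
    (Finset.disjoint_left.1 hd hx' hx)
  obtain ⟨i, rfl⟩ := (h₁.range i).2 (hS _ (Finset.left_mem_Icc.2 hij.1.le))
  obtain ⟨j, rfl⟩ := (h₁.range j).2 (hS _ (Finset.right_mem_Icc.2 hij.1.le))
  obtain ⟨m₂, T₂, e₂, h₂⟩ :=
    Cut.exists_isDeletion (T := T₁) ⟨i, j, (h₁.edge i j).2 hij, Or.inl rfl⟩
  refine ⟨m₂, T₂, e₂.trans e₁, ?_⟩
  convert h₁.trans h₂ using 2
  ext x
  simp only [Finset.mem_Ioo, Finset.mem_map, RelEmbedding.coe_toEmbedding]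
  constructor
  · rintro ⟨h1, h2⟩
    obtain ⟨x, rfl⟩ := (h₁.range x).2 (hS _ (Finset.mem_Icc.2 ⟨h1.le, h2.le⟩))
    exact ⟨x, ⟨e₁.lt_iff_lt.1 h1, e₁.lt_iff_lt.1 h2⟩, rfl⟩
  · rintro ⟨x, ⟨h1, h2⟩, rfl⟩
    exact ⟨e₁.lt_iff_lt.2 h1, e₁.lt_iff_lt.2 h2⟩

section

variable {m' : ℕ} {T' : Triangulation m'} {e : Fin m' ↪o Fin m} {S : Finset (Fin m)}

theorem IsDeletion.card_add (h : T.IsDeletion S T' e) : m' + S.card = m := by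
  have : Finset.univ.map e.toEmbedding = Sᶜ := by
    ext v
    simpa using h.range v
  have hc := congrArg Finset.card this
  have := S.card_add_card_compl
  simp only [Finset.card_map, Finset.card_univ, Fintype.card_fin] at hc this
  omega

theorem IsDeletion.map_mem_triangles (h : T.IsDeletion S T' e) {t : Finset (Fin m')}
    (ht : t ∈ T'.triangles) : t.map e.toEmbedding ∈ T.triangles := by
  obtain ⟨i, x, j, rfl, h1, h2, h3⟩ := mem_triangles_iff.1 ht
  exact mem_triangles_iff.2 ⟨e i, e x, e j, by simp [Finset.map_insert],
    (h.edge _ _).1 h1, (h.edge _ _).1 h2, (h.edge _ _).1 h3⟩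

/-- The inclusion of the triangles that survive a deletion. -/
def IsDeletion.toTriangle (h : T.IsDeletion S T' e) (t : T'.Triangle) : T.Triangle :=
  ⟨t.1.map e.toEmbedding, h.map_mem_triangles t.2⟩

theorem IsDeletion.toTriangle_injective (h : T.IsDeletion S T' e) :
    Function.Injective h.toTriangle := fun _ _ ht =>
  Subtype.ext (Finset.map_injective _ (congrArg Subtype.val ht))

theorem IsDeletion.exists_toTriangle_eq_iff (h : T.IsDeletion S T' e) (t : T.Triangle) :
    (∃ t', h.toTriangle t' = t) ↔ Disjoint t.1 S := by
  constructor
  · rintro ⟨t', rfl⟩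
    refine Finset.disjoint_left.2 fun x hx => ?_
    obtain ⟨w, -, rfl⟩ := Finset.mem_map.1 hx
    exact (h.range _).1 ⟨w, rfl⟩
  · intro hd
    obtain ⟨i, x, j, ht, h1, h2, h3⟩ := t.exists_triple
    have hS : ∀ v ∈ t.1, ∃ w, e w = v := fun v hv =>
      (h.range v).2 (Finset.disjoint_left.1 hd hv)
    obtain ⟨i, rfl⟩ := hS i (by simp [ht])
    obtain ⟨x, rfl⟩ := hS x (by simp [ht])
    obtain ⟨j, rfl⟩ := hS j (by simp [ht])
    refine ⟨⟨{i, x, j}, mem_triangles_iff.2 ⟨i, x, j, rfl,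
      (h.edge _ _).2 h1, (h.edge _ _).2 h2, (h.edge _ _).2 h3⟩⟩, Subtype.ext ?_⟩
    rw [ht]
    simp [toTriangle, Finset.map_insert]

theorem IsDeletion.neighbouring_iff (h : T.IsDeletion S T' e) (t₁ t₂ : T'.Triangle) :
    Neighbouring (h.toTriangle t₁) (h.toTriangle t₂) ↔ Neighbouring t₁ t₂ := by
  unfold Neighbouring
  rw [h.toTriangle_injective.ne_iff]
  simp only [toTriangle, ← Finset.map_inter, Finset.card_map]

end

end Triangulation

end LabelledPolygon

/-! ### Sign exponent, counting, and admissibility after a removal -/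

namespace LabelledPolygon

namespace Triangulation

/-- The contribution of a label to the sign exponent. -/
def labelWeight (x : ℤ) : ℚ :=
  if x < 0 then 1 else if x = 0 then 1 / 2 else 0

/-- This makes the weight of a square independent of its label; the half weight of the label `0` is
what covers the case `c = 0`. -/
theorem labelWeight_add_neg (x : ℤ) : labelWeight x + labelWeight (-x) = 1 := by
  unfold labelWeight
  rcases lt_trichotomy x 0 with h | h | h
  · rw [if_pos h, if_neg (by omega), if_neg (by omega)]
    norm_num
  · subst h
    norm_num
  · rw [if_neg (by omega), if_neg (by omega), if_pos (by omega)]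
    norm_num

variable {m : ℕ} {T : Triangulation m} {a : T.Labelling} {P : Finset (Finset T.Triangle)}

theorem signExponent_eq_sum (T : Triangulation m) (a : T.Labelling) :
    T.signExponent a = ∑ t, labelWeight (a t) := by
  unfold signExponent
  rw [Finset.card_filter, Finset.card_filter]
  push_cast
  rw [Finset.sum_div, ← Finset.sum_add_distrib]
  refine Finset.sum_congr rfl fun t _ => ?_
  unfold labelWeight
  rcases lt_trichotomy (a t) 0 with h | h | h
  · rw [if_pos h, if_neg (by omega), if_pos h]
    norm_num
  · rw [if_neg (by omega), if_pos h, if_neg (by omega), if_pos h]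
    norm_num
  · rw [if_neg (by omega), if_neg (by omega), if_neg (by omega), if_neg (by omega)]
    norm_num

/-- The squares partition the triangles with labels other than `1` and `-1`, so the sum can be taken
square by square. It yields both the sign exponent and the triangle count. -/
theorem IsSquarePartition.sum_eq (hP : T.IsSquarePartition a P) {f : T.Triangle → ℚ} {c : ℚ}
    (h0 : ∀ t, a t = 1 ∨ a t = -1 → f t = 0)
    (hc : ∀ t₁ t₂, a t₁ = - a t₂ → a t₁ ≠ 1 → a t₁ ≠ -1 → f t₁ + f t₂ = c) :
    ∑ t, f t = c * P.card := by
  classical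
  obtain ⟨h1, h2, h3⟩ := hP
  have hsub : ∑ t ∈ P.biUnion id, f t = ∑ t, f t := by
    refine Finset.sum_subset (Finset.subset_univ _) fun t _ ht => h0 t ?_
    by_contra hn
    rw [not_or] at hn
    obtain ⟨s, hs, hts⟩ := (h3 t).2 hn
    exact ht (Finset.mem_biUnion.2 ⟨s, hs, hts⟩)
  rw [← hsub, Finset.sum_biUnion (t := id) fun s hs s' hs' hne => h2 s hs s' hs' hne]
  rw [Finset.sum_congr rfl (g := fun _ => c), Finset.sum_const, nsmul_eq_mul, mul_comm]
  intro s hs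
  obtain ⟨t₁, t₂, rfl, hn, ha⟩ := h1 s hs
  have ht := (h3 t₁).1 ⟨_, hs, by simp⟩
  rw [id, Finset.sum_pair hn.1]
  exact hc t₁ t₂ ha ht.1 ht.2

theorem IsSquarePartition.signExponent_eq (hP : T.IsSquarePartition a P) :
    T.signExponent a = ((Finset.univ.filter fun t => a t = -1).card + P.card : ℕ) := by
  have := hP.sum_eq (f := fun t => labelWeight (a t) - if a t = -1 then 1 else 0) (c := 1) ?_ ?_
  · rw [Finset.sum_sub_distrib, ← signExponent_eq_sum, Finset.sum_boole] at this
    push_cast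
    linarith
  · rintro t (h | h) <;> simp [h, labelWeight]
  · intro t₁ t₂ h h1 h2
    have := labelWeight_add_neg (a t₁)
    have h2' : a t₂ = - a t₁ := by omega
    rw [if_neg h2, if_neg (by omega), h2']
    linarith

theorem IsSquarePartition.card_eq (hP : T.IsSquarePartition a P) :
    (Finset.univ.filter fun t => a t = 1).card + (Finset.univ.filter fun t => a t = -1).card +
      2 * P.card + 2 = m := by
  have := hP.sum_eq
    (f := fun t => 1 - (if a t = 1 then 1 else 0) - if a t = -1 then 1 else 0) (c := 2) ?_ ?_
  · rw [Finset.sum_sub_distrib, Finset.sum_sub_distrib, Finset.sum_boole, Finset.sum_boole,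
      Finset.sum_const, Finset.card_univ, card_triangle, nsmul_eq_mul, mul_one] at this
    have hm := T.two_le
    rw [Nat.cast_sub hm] at this
    push_cast at this
    rw [← Nat.cast_inj (R := ℚ)]
    push_cast
    linarith
  · rintro t (h | h) <;> simp [h]
  · intro t₁ t₂ h h1 h2
    rw [if_neg h1, if_neg h2, if_neg (by omega), if_neg (by omega)]
    norm_num

theorem Admissible.even (ha : T.Admissible a) (hP : T.IsSquarePartition a P) :
    Even ((Finset.univ.filter fun t => a t = -1).card + P.card) := by
  obtain ⟨-, n, hn, h⟩ := ha
  rw [hP.signExponent_eq] at h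
  rwa [Nat.cast_injective h]

theorem IsSquarePartition.ne_of_mem (hP : T.IsSquarePartition a P) {s : Finset T.Triangle}
    (hs : s ∈ P) {t : T.Triangle} (ht : t ∈ s) : a t ≠ 1 ∧ a t ≠ -1 :=
  (hP.2.2 t).1 ⟨s, hs, ht⟩

theorem IsSquarePartition.eq_of_mem (hP : T.IsSquarePartition a P) {s s' : Finset T.Triangle}
    (hs : s ∈ P) (hs' : s' ∈ P) {t : T.Triangle} (ht : t ∈ s) (ht' : t ∈ s') : s = s' := by
  by_contra hne
  exact Finset.disjoint_left.1 (hP.2.1 s hs s' hs' hne) ht ht'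

/-- Deleting the triangles in `R`, where `Q` are the squares that survive. -/
theorem IsDeletion.removalAdmissible {m' : ℕ} {T' : Triangulation m'} {e : Fin m' ↪o Fin m}
    {S : Finset (Fin m)} (h : T.IsDeletion S T' e) (hP : T.IsSquarePartition a P)
    {R : Finset T.Triangle} (hR : ∀ t, t ∈ R ↔ ¬ Disjoint t.1 S)
    {Q : Finset (Finset T.Triangle)} (hQP : Q ⊆ P)
    (hQ : ∀ s ∈ Q, Disjoint s R) (hQ' : ∀ s ∈ P, s ∉ Q → s ⊆ R)
    {ε : ℤ} (hε : ε = 1 ∨ ε = -1)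
    (heven : Even ((Finset.univ.filter fun t => t ∉ R ∧ a t = -ε).card + Q.card)) :
    T.RemovalAdmissible a R S ε m' := by
  classical
  have hφ : ∀ t, (∃ t', h.toTriangle t' = t) ↔ t ∉ R := by
    intro t
    rw [h.exists_toTriangle_eq_iff, hR, not_not]
  let a' : T'.Labelling := fun t' => ε * a (h.toTriangle t')
  -- The squares of the smaller triangulation are the preimages of those in `Q`. All triangles of
  -- the latter survive, so no square is truncated and distinct ones stay distinct.
  let F : Finset T.Triangle → Finset T'.Triangle :=
    fun s => s.preimage h.toTriangle h.toTriangle_injective.injOn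
  have hF : ∀ s t', t' ∈ F s ↔ h.toTriangle t' ∈ s := fun s t' => Finset.mem_preimage
  have hsurj : ∀ s ∈ Q, ∀ t ∈ s, ∃ t', h.toTriangle t' = t := fun s hs t ht =>
    (hφ t).2 (Finset.disjoint_left.1 (hQ s hs) ht)
  have hFinj : Set.InjOn F Q := by
    intro s hs s' hs' heq
    ext t
    constructor
    · intro ht
      obtain ⟨t', rfl⟩ := hsurj s hs t ht
      rwa [← hF, ← heq, hF]
    · intro ht
      obtain ⟨t', rfl⟩ := hsurj s' hs' t ht
      rwa [← hF, heq, hF]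
  have hlab : ∀ t', (a' t' ≠ 1 ∧ a' t' ≠ -1) ↔ (a (h.toTriangle t') ≠ 1 ∧
      a (h.toTriangle t') ≠ -1) := by
    intro t'
    simp only [a']
    rcases hε with rfl | rfl <;> omega
  have hP' : T'.IsSquarePartition a' (Q.image F) := by
    refine ⟨?_, ?_, ?_⟩
    · intro _ hsF
      obtain ⟨s, hs, rfl⟩ := Finset.mem_image.1 hsF
      obtain ⟨t₁, t₂, hs12, hn, ha⟩ := hP.1 s (hQP hs)
      obtain ⟨t₁, rfl⟩ := hsurj s hs t₁ (by simp [hs12])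
      obtain ⟨t₂, rfl⟩ := hsurj s hs t₂ (by simp [hs12])
      refine ⟨t₁, t₂, ?_, (h.neighbouring_iff _ _).1 hn, ?_⟩
      · ext t
        rw [hF, hs12]
        simp [h.toTriangle_injective.eq_iff]
      · simp only [a', ha, mul_neg]
    · intro _ hsF _ hsF' hne
      obtain ⟨s, hs, rfl⟩ := Finset.mem_image.1 hsF
      obtain ⟨s', hs', rfl⟩ := Finset.mem_image.1 hsF'
      refine Finset.disjoint_left.2 fun t ht ht' => hne ?_
      rw [hF] at ht ht'
      rw [hP.eq_of_mem (hQP hs) (hQP hs') ht ht']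
    · intro t
      rw [hlab, ← hP.2.2]
      constructor
      · rintro ⟨_, hsF, ht⟩
        obtain ⟨s, hs, rfl⟩ := Finset.mem_image.1 hsF
        exact ⟨s, hQP hs, (hF _ _).1 ht⟩
      · rintro ⟨s, hs, ht⟩
        by_cases hsQ : s ∈ Q
        · exact ⟨F s, Finset.mem_image_of_mem _ hsQ, (hF _ _).2 ht⟩
        · exact absurd (hQ' s hs hsQ ht) ((hφ _).1 ⟨t, rfl⟩)
  -- As `ε` is its own inverse, the new labels `-1` are the surviving old labels `-ε`.
  have hcard : (Finset.univ.filter fun t' => a' t' = -1).card =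
      (Finset.univ.filter fun t => t ∉ R ∧ a t = -ε).card := by
    rw [← Finset.card_image_of_injective _ h.toTriangle_injective]
    congr 1
    ext t
    simp only [Finset.mem_image, Finset.mem_filter, Finset.mem_univ, true_and, ← hφ]
    constructor
    · rintro ⟨t', ht', rfl⟩
      refine ⟨⟨t', rfl⟩, ?_⟩
      simp only [a'] at ht'
      rcases hε with rfl | rfl <;> omega
    · rintro ⟨⟨t', rfl⟩, ht'⟩
      refine ⟨t', ?_, rfl⟩
      simp only [a', ht']
      rcases hε with rfl | rfl <;> norm_num
  refine ⟨T', a', e, h.range, ?_, ?_, ⟨_, hP'⟩, _, ?_, hP'.signExponent_eq⟩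
  · intro t ht
    obtain ⟨t', rfl⟩ := (hφ t).2 ht
    exact ⟨t', rfl⟩
  · intro t'
    exact ⟨h.toTriangle t', (hφ _).1 ⟨t', rfl⟩, rfl, rfl⟩
  · rwa [hcard, Finset.card_image_of_injOn hFinj]

end Triangulation

end LabelledPolygon

/-! ### Edges that do not cut a square, and the nodes below them -/

namespace LabelledPolygon

namespace Triangulation

variable {m : ℕ} {T : Triangulation m} {a : T.Labelling} {P : Finset (Finset T.Triangle)}

theorem Triangle.edge (t : T.Triangle) {p q : Fin m} (hp : p ∈ t.1) (hq : q ∈ t.1) (h : p < q) :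
    T.Edge p q :=
  ⟨h, (Finset.mem_filter.1 t.2).2.2 p hp q hq h⟩

theorem Triangle.card_eq (t : T.Triangle) : t.1.card = 3 :=
  (Finset.mem_filter.1 t.2).2.1

theorem Triangle.not_cross (t t' : T.Triangle) {p q r s : Fin m} (hp : p ∈ t.1) (hr : r ∈ t.1)
    (hq : q ∈ t'.1) (hs : s ∈ t'.1) : ¬ (p < q ∧ q < r ∧ r < s) := fun h =>
  (t.edge hp hr (h.1.trans h.2.1)).not_cross (t'.edge hq hs (h.2.1.trans h.2.2)) h

theorem Edge.not_cross_triangle {p q r s : Fin m} (h : T.Edge p r) (t : T.Triangle)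
    (hq : q ∈ t.1) (hs : s ∈ t.1) : ¬ (p < q ∧ q < r ∧ r < s) := fun h' =>
  h.not_cross (t.edge hq hs (h'.2.1.trans h'.2.2)) h'

theorem Edge.not_cross_triangle' {p q r s : Fin m} (h : T.Edge q s) (t : T.Triangle)
    (hp : p ∈ t.1) (hr : r ∈ t.1) : ¬ (p < q ∧ q < r ∧ r < s) := fun h' =>
  (t.edge hp hr (h'.1.trans h'.2.1)).not_cross h h'

theorem Triangle.eq_insert (t : T.Triangle) {p q r : Fin m} (hp : p ∈ t.1) (hq : q ∈ t.1)
    (hr : r ∈ t.1) (hpq : p ≠ q) (hpr : p ≠ r) (hqr : q ≠ r) : t.1 = {p, q, r} := by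
  symm
  apply Finset.eq_of_subset_of_card_le
  · intro x hx
    simp only [Finset.mem_insert, Finset.mem_singleton] at hx
    rcases hx with rfl | rfl | rfl <;> assumption
  · rw [t.card_eq, Finset.card_eq_three.2 ⟨p, q, r, hpq, hpr, hqr, rfl⟩]

/-- Neighbouring triangles on different sides of an edge share that edge. -/
theorem Neighbouring.mem_of_edge {t₁ t₂ : T.Triangle} (hn : Neighbouring t₁ t₂) {u v : Fin m}
    (h : T.Edge u v) (h₁ : t₁.1 ⊆ Finset.Icc u v) (h₂ : ¬ t₂.1 ⊆ Finset.Icc u v) :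
    u ∈ t₂.1 ∧ v ∈ t₂.1 := by
  obtain ⟨p, q, hpq, he⟩ := Finset.card_eq_two.1 hn.2
  obtain ⟨r, hr, hr'⟩ := Finset.not_subset.1 h₂
  -- A common vertex strictly between `u` and `v` would be joined to the outside vertex `r` by an
  -- edge crossing `(u, v)`.
  have key : ∀ w ∈ t₁.1 ∩ t₂.1, w = u ∨ w = v := by
    intro w hw
    obtain ⟨hw1, hw2⟩ := Finset.mem_inter.1 hw
    have hw1 := Finset.mem_Icc.1 (h₁ hw1)
    have a1 := h.not_cross_triangle t₂ hw2 hr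
    have a2 := h.not_cross_triangle' t₂ hr hw2
    rw [Finset.mem_Icc] at hr'
    omega
  have hp : p ∈ t₁.1 ∩ t₂.1 := by simp [he]
  have hq : q ∈ t₁.1 ∩ t₂.1 := by simp [he]
  have hp2 := (Finset.mem_inter.1 hp).2
  have hq2 := (Finset.mem_inter.1 hq).2
  rcases key p hp with rfl | rfl <;> rcases key q hq with rfl | rfl
  · exact absurd rfl hpq
  · exact ⟨hp2, hq2⟩
  · exact ⟨hq2, hp2⟩
  · exact absurd rfl hpq

/-- There is at most one triangle above an edge. -/
theorem Triangle.eq_of_not_subset {t t' : T.Triangle} {u v : Fin m} (huv : u < v)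
    (hu : u ∈ t.1) (hv : v ∈ t.1) (hu' : u ∈ t'.1) (hv' : v ∈ t'.1)
    (h : ¬ t.1 ⊆ Finset.Icc u v) (h' : ¬ t'.1 ⊆ Finset.Icc u v) : t = t' := by
  obtain ⟨r, hr, hr1⟩ := Finset.not_subset.1 h
  obtain ⟨r', hr', hr1'⟩ := Finset.not_subset.1 h'
  rw [Finset.mem_Icc] at hr1 hr1'
  have a1 := t.not_cross t' hr hu hr' hv'
  have a2 := t'.not_cross t hr' hu' hr hv
  have a3 := t.not_cross t' hr hv hu' hr'
  have a4 := t'.not_cross t hr' hv' hu hr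
  have a5 := t.not_cross t' hu hr hv' hr'
  have a6 := t'.not_cross t hu' hr' hv hr
  have : r = r' := by omega
  subst this
  apply Subtype.ext
  rw [t.eq_insert hu hv hr (by omega) (by omega) (by omega),
    t'.eq_insert hu' hv' hr' (by omega) (by omega) (by omega)]

/-- An edge of `T` that does not separate the two triangles of a square. -/
def IsNodeEdge (T : Triangulation m) (P : Finset (Finset T.Triangle)) (u v : Fin m) : Prop :=
  T.Edge u v ∧ ∀ s ∈ P, ∀ t₁ ∈ s, ∀ t₂ ∈ s, t₁.1 ⊆ Finset.Icc u v → t₂.1 ⊆ Finset.Icc u v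

/-- If `(u, v)` separated a square, the outer triangle of that square would contain `u` and `v`,
hence be `t`, the only triangle above the edge. So only a square containing `t` has to be checked.
-/
theorem isNodeEdge_of_triangle_above (hP : T.IsSquarePartition a P) {u v : Fin m} {t : T.Triangle}
    (huv : u < v) (hu : u ∈ t.1) (hv : v ∈ t.1) (ht : ¬ t.1 ⊆ Finset.Icc u v)
    (hs : ∀ s ∈ P, t ∈ s → ∀ t' ∈ s, ¬ t'.1 ⊆ Finset.Icc u v) : T.IsNodeEdge P u v := by
  have h := t.edge hu hv huv
  refine ⟨h, fun s hsP t₁ h₁ t₂ h₂ hsub => ?_⟩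
  by_contra hsub'
  obtain ⟨x, y, rfl, hn, -⟩ := hP.1 s hsP
  have hn' : Neighbouring y x := ⟨hn.1.symm, by rw [Finset.inter_comm]; exact hn.2⟩
  have hn12 : Neighbouring t₁ t₂ := by
    simp only [Finset.mem_insert, Finset.mem_singleton] at h₁ h₂
    rcases h₁ with rfl | rfl <;> rcases h₂ with rfl | rfl
    exacts [absurd hsub hsub', hn, hn', absurd hsub hsub']
  obtain ⟨hu2, hv2⟩ := hn12.mem_of_edge h hsub hsub'
  have := Triangle.eq_of_not_subset huv hu hv hu2 hv2 ht hsub'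
  subst this
  exact hs _ hsP h₂ t₁ h₁ hsub

/-- The triangle or square below an edge that does not cut a square. -/
theorem IsNodeEdge.exists_node (hP : T.IsSquarePartition a P) {i j : Fin m}
    (h : T.IsNodeEdge P i j) (hij : i.val + 1 < j.val) :
    (∃ (x : Fin m) (t : T.Triangle), i < x ∧ x < j ∧ t.1 = {i, x, j} ∧ (a t = 1 ∨ a t = -1) ∧
      T.IsNodeEdge P i x ∧ T.IsNodeEdge P x j) ∨
    (∃ (x y : Fin m) (t₁ t₂ : T.Triangle), i < x ∧ x < y ∧ y < j ∧ {t₁, t₂} ∈ P ∧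
      Neighbouring t₁ t₂ ∧ a t₁ = - a t₂ ∧ t₁.1 ∪ t₂.1 = {i, x, y, j} ∧
      T.IsNodeEdge P i x ∧ T.IsNodeEdge P x y ∧ T.IsNodeEdge P y j) := by
  obtain ⟨x, hix, hxj, e1, e2⟩ := h.1.exists_apex hij
  have htri : T.IsTriple i x j := ⟨e1, e2, h.1⟩
  obtain ⟨t, ht⟩ : ∃ t : T.Triangle, t.1 = {i, x, j} := ⟨htri.triangle, rfl⟩
  have hi : i ∈ t.1 := by simp [ht]
  have hx : x ∈ t.1 := by simp [ht]
  have hj : j ∈ t.1 := by simp [ht]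
  have out : ∀ {u v w : Fin m} {t : T.Triangle}, w ∈ t.1 → w < u ∨ v < w →
      ¬ t.1 ⊆ Finset.Icc u v := by
    intro u v w t hw hw' hsub
    have := Finset.mem_Icc.1 (hsub hw)
    omega
  by_cases hlab : a t = 1 ∨ a t = -1
  · have hno : ∀ s ∈ P, t ∉ s := fun s hs hts => by
      have := hP.ne_of_mem hs hts
      tauto
    exact Or.inl ⟨x, t, hix, hxj, ht, hlab,
      isNodeEdge_of_triangle_above hP hix hi hx (out hj (Or.inr hxj))
        fun s hs hts => absurd hts (hno s hs),
      isNodeEdge_of_triangle_above hP hxj hx hj (out hi (Or.inl hix))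
        fun s hs hts => absurd hts (hno s hs)⟩
  · right
    rw [not_or] at hlab
    obtain ⟨s, hs, hts⟩ := (hP.2.2 t).2 hlab
    obtain ⟨t', rfl, hn, hopp⟩ : ∃ t', s = {t, t'} ∧ Neighbouring t t' ∧ a t = - a t' := by
      obtain ⟨t₁, t₂, rfl, hn, hopp⟩ := hP.1 s hs
      simp only [Finset.mem_insert, Finset.mem_singleton] at hts
      rcases hts with rfl | rfl
      · exact ⟨t₂, rfl, hn, hopp⟩
      · exact ⟨t₁, Finset.pair_comm _ _, ⟨hn.1.symm, by rw [Finset.inter_comm]; exact hn.2⟩,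
          by omega⟩
    have node : ∀ {u v : Fin m} {t₀ : T.Triangle}, t₀ ∈ ({t, t'} : Finset T.Triangle) → u < v →
        u ∈ t₀.1 → v ∈ t₀.1 → ¬ t.1 ⊆ Finset.Icc u v → ¬ t'.1 ⊆ Finset.Icc u v →
        T.IsNodeEdge P u v := by
      intro u v t₀ ht₀ huv hu hv h1 h2
      have hall : ∀ t'' ∈ ({t, t'} : Finset T.Triangle), ¬ t''.1 ⊆ Finset.Icc u v := by
        intro t'' ht''
        simp only [Finset.mem_insert, Finset.mem_singleton] at ht''
        rcases ht'' with rfl | rfl <;> assumption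
      refine isNodeEdge_of_triangle_above hP huv hu hv (hall _ ht₀) fun s' hs' hts' => ?_
      rw [hP.eq_of_mem hs' hs hts' ht₀]
      exact hall
    -- Because `(i, j)` does not cut the square, the partner of `t` also lies below it, and must be
    -- glued along `(i, x)` or `(x, j)`.
    have hsub : t'.1 ⊆ Finset.Icc i j := by
      refine h.2 _ hs t (by simp) t' (by simp) ?_
      rw [ht]
      intro w hw
      simp only [Finset.mem_insert, Finset.mem_singleton] at hw
      rw [Finset.mem_Icc]
      rcases hw with rfl | rfl | rfl <;> omega
    obtain ⟨r, hr, hrt⟩ : ∃ r ∈ t'.1, r ∉ t.1 := by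
      by_contra! hc
      have : t'.1 ∩ t.1 = t'.1 := Finset.inter_eq_left.2 hc
      have h2 := hn.2
      rw [Finset.inter_comm, this, t'.card_eq] at h2
      omega
    have hr' : i < r ∧ r < j ∧ r ≠ x := by
      have := Finset.mem_Icc.1 (hsub hr)
      rw [ht] at hrt
      simp only [Finset.mem_insert, Finset.mem_singleton, not_or] at hrt
      omega
    have two : ∀ y z : Fin m, (∀ w ∈ t.1 ∩ t'.1, w = y ∨ w = z) → y ∈ t'.1 ∧ z ∈ t'.1 := by
      intro y z hw
      have hsub : t.1 ∩ t'.1 ⊆ {y, z} := fun w hw' => by simpa using hw w hw'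
      have heq := Finset.eq_of_subset_of_card_le hsub
        (by rw [hn.2]; exact Finset.card_le_two)
      have hy : y ∈ t.1 ∩ t'.1 := by simp [heq]
      have hz : z ∈ t.1 ∩ t'.1 := by simp [heq]
      exact ⟨(Finset.mem_inter.1 hy).2, (Finset.mem_inter.1 hz).2⟩
    -- The position of the fourth vertex `r` decides the common side: if `r < x`, then `j` is not a
    -- vertex of `t'`, as `(r, j)` would cross `(i, x)`; the other case is symmetric.
    rcases lt_or_gt_of_ne hr'.2.2 with hrx | hrx
    · obtain ⟨hi', hx'⟩ := two i x (by
        intro w hw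
        obtain ⟨hw1, hw2⟩ := Finset.mem_inter.1 hw
        have := t.not_cross t' hi hx hr hw2
        rw [ht] at hw1
        simp only [Finset.mem_insert, Finset.mem_singleton] at hw1
        omega)
      have ht' := t'.eq_insert hi' hr hx' (by omega) (by omega) (by omega)
      refine ⟨r, x, t, t', hr'.1, hrx, hxj, hs, hn, hopp, ?_, ?_, ?_, ?_⟩
      · rw [ht, ht']
        ext w
        simp only [Finset.mem_union, Finset.mem_insert, Finset.mem_singleton]
        tauto
      · exact node (t₀ := t') (by simp) hr'.1 hi' hr (out hx (Or.inr hrx)) (out hx' (Or.inr hrx))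
      · exact node (t₀ := t') (by simp) hrx hr hx' (out hi (Or.inl hr'.1)) (out hi' (Or.inl hr'.1))
      · exact node (t₀ := t) (by simp) hxj hx hj (out hi (Or.inl hix)) (out hi' (Or.inl hix))
    · obtain ⟨hx', hj'⟩ := two x j (by
        intro w hw
        obtain ⟨hw1, hw2⟩ := Finset.mem_inter.1 hw
        have := t'.not_cross t hw2 hr hx hj
        rw [ht] at hw1
        simp only [Finset.mem_insert, Finset.mem_singleton] at hw1
        omega)
      have ht' := t'.eq_insert hx' hr hj' (by omega) (by omega) (by omega)
      refine ⟨x, r, t, t', hix, hrx, hr'.2.1, hs, hn, hopp, ?_, ?_, ?_, ?_⟩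
      · rw [ht, ht']
        ext w
        simp only [Finset.mem_union, Finset.mem_insert, Finset.mem_singleton]
        tauto
      · exact node (t₀ := t) (by simp) hix hi hx (out hj (Or.inr hxj)) (out hj' (Or.inr hxj))
      · exact node (t₀ := t') (by simp) hrx hx' hr (out hj (Or.inr hr'.2.1))
          (out hj' (Or.inr hr'.2.1))
      · exact node (t₀ := t') (by simp) hr'.2.1 hr hj' (out hx (Or.inl hrx)) (out hx' (Or.inl hrx))

end Triangulation

end LabelledPolygon

/-! ### Leaves of the tree of triangles and squares -/

namespace LabelledPolygon

theorem val_finRotate {m : ℕ} (k : Fin m) :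
    (finRotate m k).val = if k.val + 1 = m then 0 else k.val + 1 := by
  obtain _ | n := m
  · exact k.elim0
  · rw [finRotate_apply, Fin.val_add_one]
    have : k = Fin.last n ↔ k.val + 1 = n + 1 := by
      rw [Fin.ext_iff, Fin.val_last]
      omega
    simp only [this]

theorem finRotate_eq_iff {m : ℕ} {k l : Fin m} :
    finRotate m k = l ↔ l.val = k.val + 1 ∨ (l.val = 0 ∧ k.val + 1 = m) := by
  have := l.isLt
  rw [Fin.ext_iff, val_finRotate]
  split_ifs <;> omega

theorem finRotate_symm_eq_iff {m : ℕ} {k l : Fin m} :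
    (finRotate m).symm k = l ↔ k.val = l.val + 1 ∨ (k.val = 0 ∧ l.val + 1 = m) := by
  rw [Equiv.symm_apply_eq, eq_comm, finRotate_eq_iff]

namespace Triangulation

variable {m : ℕ} {T : Triangulation m} {a : T.Labelling} {P : Finset (Finset T.Triangle)}

/-- A triangle meeting the open interval cannot cross `(i, j)`, so it lies below that edge. As
middle vertices identify triangles, this bounds the triangles destroyed by a cut. -/
theorem Edge.mid_of_not_disjoint_Ioo {i j : Fin m} (h : T.Edge i j) {t : T.Triangle}
    (ht : ¬ Disjoint t.1 (Finset.Ioo i j)) : i < t.mid ∧ t.mid < j := by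
  obtain ⟨w, hw, hw'⟩ := Finset.not_disjoint_iff.1 ht
  obtain ⟨p, q, he, h1, h2, h3⟩ := t.exists_eq
  have a1 := h.not_cross h3
  have a2 := h3.not_cross h
  have := h1.1
  have := h2.1
  rw [he] at hw
  simp only [Finset.mem_insert, Finset.mem_singleton] at hw
  rw [Finset.mem_Ioo] at hw'
  omega

theorem Edge.mid_of_not_disjoint_compl_Icc {i j : Fin m} (h : T.Edge i j) {t : T.Triangle}
    (ht : ¬ Disjoint t.1 (Finset.Icc i j)ᶜ) : t.mid ≤ i ∨ j ≤ t.mid := by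
  obtain ⟨w, hw, hw'⟩ := Finset.not_disjoint_iff.1 ht
  obtain ⟨p, q, he, h1, h2, h3⟩ := t.exists_eq
  have a1 := h.not_cross h2
  have a2 := h1.not_cross h
  have := h1.1
  have := h2.1
  rw [he] at hw
  simp only [Finset.mem_insert, Finset.mem_singleton] at hw
  rw [Finset.mem_compl, Finset.mem_Icc] at hw'
  omega

/-- The triangles in `R` form a triangle labelled `1` or `-1`, or a square, all of whose sides but
one are sides of the polygon; `S` are the vertices, starting with `k`, that only lie in `R`. -/
def IsLeaf (T : Triangulation m) (a : T.Labelling) (P : Finset (Finset T.Triangle)) (k : Fin m)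
    (R : Finset T.Triangle) (S : Finset (Fin m)) : Prop :=
  T.Cut S ∧ (∀ t, t ∈ R ↔ ¬ Disjoint t.1 S) ∧
    ((∃ t, R = {t} ∧ S = {k} ∧ T.IsEarTriangle t k ∧ (a t = 1 ∨ a t = -1)) ∨
      (∃ c, R ∈ P ∧ S = {k, finRotate m k} ∧ T.IsBoundarySquare a R k c))

theorem IsLeaf.mem {k : Fin m} {R : Finset T.Triangle} {S : Finset (Fin m)}
    (h : T.IsLeaf a P k R S) : k ∈ S := by
  obtain ⟨-, -, ⟨t, -, rfl, -⟩ | ⟨c, -, rfl, -⟩⟩ := h <;> simp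

/-- All triangles meeting `S` have the same middle vertex, and `t` is one of them. -/
theorem isLeaf_singleton {k : Fin m} {t : T.Triangle} {S : Finset (Fin m)} {n : ℕ}
    (hcut : T.Cut S) (hS : S = {k}) (ht : T.IsEarTriangle t k) (ha : a t = 1 ∨ a t = -1)
    (hmid : ∀ t' : T.Triangle, ¬ Disjoint t'.1 S → t'.mid.val = n) : T.IsLeaf a P k {t} S := by
  have hk : ¬ Disjoint t.1 S := by
    have : k ∈ t.1 := by
      rw [ht]
      simp
    exact Finset.not_disjoint_iff.2 ⟨k, this, by simp [hS]⟩
  refine ⟨hcut, fun t' => ?_, Or.inl ⟨t, rfl, hS, ht, ha⟩⟩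
  rw [Finset.mem_singleton]
  constructor
  · rintro rfl
    exact hk
  · intro h
    exact Triangle.mid_injective (Fin.ext ((hmid _ h).trans (hmid _ hk).symm))

/-- Only two vertices of the square lie outside `S`, so both of its triangles meet `S`. They use up
the two possible middle vertices, which leaves no room for a third triangle. -/
theorem isLeaf_pair {k : Fin m} {t₁ t₂ : T.Triangle} {S : Finset (Fin m)} {n n' : ℕ}
    (hcut : T.Cut S) (hS : S = {k, finRotate m k}) (hP : {t₁, t₂} ∈ P) (hn : Neighbouring t₁ t₂)
    (ha : a t₁ = - a t₂)
    (hU : t₁.1 ∪ t₂.1 = {(finRotate m).symm k, k, finRotate m k, finRotate m (finRotate m k)})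
    (hmid : ∀ t' : T.Triangle, ¬ Disjoint t'.1 S → t'.mid.val = n ∨ t'.mid.val = n') :
    T.IsLeaf a P k {t₁, t₂} S := by
  have meets : ∀ t : T.Triangle, t.1 ⊆ t₁.1 ∪ t₂.1 → ¬ Disjoint t.1 S := by
    intro t ht hd
    have : t.1 ⊆ {(finRotate m).symm k, finRotate m (finRotate m k)} := by
      intro w hw
      have h1 := ht hw
      have h2 := Finset.disjoint_left.1 hd hw
      rw [hU] at h1
      rw [hS] at h2
      simp only [Finset.mem_insert, Finset.mem_singleton] at h1 h2 ⊢
      tauto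
    have := Finset.card_le_card this
    have h2 := Finset.card_le_two (a := (finRotate m).symm k) (b := finRotate m (finRotate m k))
    rw [t.card_eq] at this
    omega
  have h₁ := meets t₁ Finset.subset_union_left
  have h₂ := meets t₂ Finset.subset_union_right
  refine ⟨hcut, fun t => ?_, Or.inr ⟨a t₁, hP, hS, t₁, t₂, rfl, hn, hU, rfl, by omega⟩⟩
  rw [Finset.mem_insert, Finset.mem_singleton]
  constructor
  · rintro (rfl | rfl) <;> assumption
  · intro h
    have hne : t₁.mid ≠ t₂.mid := fun h => hn.1 (Triangle.mid_injective h)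
    have a0 := hmid _ h
    have a1 := hmid _ h₁
    have a2 := hmid _ h₂
    have : t.mid = t₁.mid ∨ t.mid = t₂.mid := by omega
    exact this.imp (fun h => Triangle.mid_injective h) (fun h => Triangle.mid_injective h)

/-- Induction on the length of the edge: if a lower side of the node below it is not a side of the
polygon, there is a leaf below that lower side; otherwise the node itself is a leaf. -/
theorem IsNodeEdge.exists_isLeaf (hP : T.IsSquarePartition a P) {i j : Fin m}
    (h : T.IsNodeEdge P i j) (hij : i.val + 1 < j.val) :
    ∃ (i' j' k : Fin m) (R : Finset T.Triangle), i ≤ i' ∧ j' ≤ j ∧ T.Edge i' j' ∧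
      T.IsLeaf a P k R (Finset.Ioo i' j') := by
  induction hd : j.val - i.val using Nat.strong_induction_on generalizing i j with
  | _ d ih =>
    have descend : ∀ u v : Fin m, T.IsNodeEdge P u v → i ≤ u → v ≤ j → (i < u ∨ v < j) →
        v.val = u.val + 1 ∨ ∃ (i' j' k : Fin m) (R : Finset T.Triangle), i ≤ i' ∧ j' ≤ j ∧
          T.Edge i' j' ∧ T.IsLeaf a P k R (Finset.Ioo i' j') := by
      intro u v huv hiu hvj hlt
      have := huv.1.1
      by_cases hs : v.val = u.val + 1
      · exact Or.inl hs
      · obtain ⟨i', j', k, R, h1, h2, h3⟩ := ih (v.val - u.val) (by omega) huv (by omega) rfl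
        exact Or.inr ⟨i', j', k, R, hiu.trans h1, h2.trans hvj, h3⟩
    have hcut : T.Cut (Finset.Ioo i j) := ⟨i, j, h.1, Or.inl rfl⟩
    rcases h.exists_node hP hij with ⟨x, t, hix, hxj, ht, ha, n1, n2⟩ |
      ⟨x, y, t₁, t₂, hix, hxy, hyj, hs, hn, ha, hU, n1, n2, n3⟩
    · rcases descend i x n1 le_rfl hxj.le (Or.inr hxj) with s1 | hl
      swap
      · exact hl
      rcases descend x j n2 hix.le le_rfl (Or.inl hix) with s2 | hl
      swap
      · exact hl
      refine ⟨i, j, x, {t}, le_rfl, le_rfl, h.1, ?_⟩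
      refine isLeaf_singleton (n := x.val) hcut ?_ ?_ ha ?_
      · ext w
        rw [Finset.mem_Ioo, Finset.mem_singleton]
        omega
      · rw [IsEarTriangle, finRotate_symm_eq_iff.2 (Or.inl s1), finRotate_eq_iff.2 (Or.inl s2), ht]
      · intro t' ht'
        have := h.1.mid_of_not_disjoint_Ioo ht'
        omega
    · rcases descend i x n1 le_rfl (by omega) (Or.inr (by omega)) with s1 | hl
      swap
      · exact hl
      rcases descend x y n2 (by omega) (by omega) (Or.inl hix) with s2 | hl
      swap
      · exact hl
      rcases descend y j n3 (by omega) le_rfl (Or.inl (by omega)) with s3 | hl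
      swap
      · exact hl
      have e2 := finRotate_eq_iff.2 (Or.inl s2)
      refine ⟨i, j, x, {t₁, t₂}, le_rfl, le_rfl, h.1, ?_⟩
      refine isLeaf_pair (n := x.val) (n' := y.val) hcut ?_ hs hn ha ?_ ?_
      · rw [e2]
        ext w
        rw [Finset.mem_Ioo, Finset.mem_insert, Finset.mem_singleton]
        omega
      · rw [e2, finRotate_symm_eq_iff.2 (Or.inl s1), finRotate_eq_iff.2 (Or.inl s3), hU]
      · intro t' ht'
        have := h.1.mid_of_not_disjoint_Ioo ht'
        omega

/-- Unless it consists of a single triangle or square, a triangulation has two leaves. -/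
theorem exists_two_leaves (hP : T.IsSquarePartition a P) (hm : 3 ≤ m) :
    (m = 3 ∧ ∃ t, a t = 1 ∨ a t = -1) ∨ (m = 4 ∧ P.Nonempty) ∨
    ∃ (k₁ k₂ i j : Fin m) (R₁ R₂ : Finset T.Triangle) (S : Finset (Fin m)),
      T.IsLeaf a P k₁ R₁ S ∧ T.Edge i j ∧ T.IsLeaf a P k₂ R₂ (Finset.Ioo i j) ∧
      Disjoint S (Finset.Icc i j) := by
  obtain ⟨o, ho⟩ : ∃ o : Fin m, o.val = 0 := ⟨⟨0, by omega⟩, rfl⟩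
  obtain ⟨l, hl⟩ : ∃ l : Fin m, l.val + 1 = m := ⟨⟨m - 1, by omega⟩, by simp only; omega⟩
  -- The whole polygon lies below its side from the first to the last vertex, so the node at this
  -- side serves as root.
  have hroot : T.IsNodeEdge P o l := by
    refine ⟨edge_of_isSide (by omega) (Or.inr ⟨ho, hl⟩), fun s _ t₁ _ t₂ _ _ w _ => ?_⟩
    rw [Finset.mem_Icc]
    omega
  have inner : ∀ {u v u' v' : Fin m}, T.IsNodeEdge P u v → T.IsNodeEdge P u' v' →
      v ≤ u' → v.val ≠ u.val + 1 → v'.val ≠ u'.val + 1 →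
      ∃ (k₁ k₂ i j : Fin m) (R₁ R₂ : Finset T.Triangle) (S : Finset (Fin m)),
        T.IsLeaf a P k₁ R₁ S ∧ T.Edge i j ∧ T.IsLeaf a P k₂ R₂ (Finset.Ioo i j) ∧
        Disjoint S (Finset.Icc i j) := by
    intro u v u' v' h h' hle hne hne'
    have := h.1.1
    have := h'.1.1
    obtain ⟨i₁, j₁, k₁, R₁, h1, h2, h3, hl₁⟩ := h.exists_isLeaf hP (by omega)
    obtain ⟨i₂, j₂, k₂, R₂, h1', h2', h3', hl₂⟩ := h'.exists_isLeaf hP (by omega)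
    refine ⟨k₁, k₂, i₂, j₂, R₁, R₂, _, hl₁, h3', hl₂, Finset.disjoint_left.2 fun w hw => ?_⟩
    rw [Finset.mem_Ioo] at hw
    rw [Finset.mem_Icc]
    omega
  -- If `(u, v)` is the only lower side of the root node that is not a side of the polygon, the root
  -- is a leaf, cut off by `(u, v)` from above; the second leaf lies below `(u, v)`.
  have outer : ∀ {u v k : Fin m} {R : Finset T.Triangle}, T.IsNodeEdge P u v →
      v.val ≠ u.val + 1 → (T.Cut (Finset.Icc u v)ᶜ → T.IsLeaf a P k R (Finset.Icc u v)ᶜ) →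
      ∃ (k₁ k₂ i j : Fin m) (R₁ R₂ : Finset T.Triangle) (S : Finset (Fin m)),
        T.IsLeaf a P k₁ R₁ S ∧ T.Edge i j ∧ T.IsLeaf a P k₂ R₂ (Finset.Ioo i j) ∧
        Disjoint S (Finset.Icc i j) := by
    intro u v k R h hne hleaf
    have := h.1.1
    obtain ⟨i₁, j₁, k₁, R₁, h1, h2, h3, hl₁⟩ := h.exists_isLeaf hP (by omega)
    refine ⟨k, k₁, i₁, j₁, R, R₁, _, hleaf ⟨u, v, h.1, Or.inr rfl⟩, h3, hl₁,
      Finset.disjoint_left.2 fun w hw => ?_⟩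
    rw [Finset.mem_compl, Finset.mem_Icc] at hw
    rw [Finset.mem_Icc]
    omega
  have midc : ∀ {u v : Fin m}, T.IsNodeEdge P u v → ∀ t : T.Triangle,
      ¬ Disjoint t.1 (Finset.Icc u v)ᶜ →
      0 < t.mid.val ∧ t.mid.val + 1 < m ∧ (t.mid ≤ u ∨ v ≤ t.mid) := fun h t ht =>
    ⟨t.mid_pos.1, t.mid_pos.2, h.1.mid_of_not_disjoint_compl_Icc ht⟩
  -- Count the lower sides of the root node that are not sides of the polygon. With none, the root
  -- is everything; with one, `outer` applies; with two or more, `inner` gives leaves below two of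
  -- them.
  rcases hroot.exists_node hP (by omega) with ⟨x, t, hix, hxj, ht, ha, n1, n2⟩ |
      ⟨x, y, t₁, t₂, hix, hxy, hyj, hs, hn, ha, hU, n1, n2, n3⟩
  · by_cases s1 : x.val = o.val + 1 <;> by_cases s2 : l.val = x.val + 1
    · exact Or.inl ⟨by omega, t, ha⟩
    · refine Or.inr (Or.inr (outer (k := o) (R := {t}) n2 s2 fun hcut => ?_))
      refine isLeaf_singleton (n := x.val) hcut ?_ ?_ ha fun t' ht' => ?_
      · ext w
        rw [Finset.mem_compl, Finset.mem_Icc, Finset.mem_singleton]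
        omega
      · rw [IsEarTriangle, finRotate_symm_eq_iff.2 (Or.inr ⟨ho, hl⟩),
          finRotate_eq_iff.2 (Or.inl s1), ht]
        ext w
        simp only [Finset.mem_insert, Finset.mem_singleton]
        tauto
      · have := midc n2 t' ht'
        omega
    · refine Or.inr (Or.inr (outer (k := l) (R := {t}) n1 s1 fun hcut => ?_))
      refine isLeaf_singleton (n := x.val) hcut ?_ ?_ ha fun t' ht' => ?_
      · ext w
        rw [Finset.mem_compl, Finset.mem_Icc, Finset.mem_singleton]
        omega
      · rw [IsEarTriangle, finRotate_symm_eq_iff.2 (Or.inl s2),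
          finRotate_eq_iff.2 (Or.inr ⟨ho, hl⟩), ht]
        ext w
        simp only [Finset.mem_insert, Finset.mem_singleton]
        tauto
      · have := midc n1 t' ht'
        omega
    · exact Or.inr (Or.inr (inner n1 n2 le_rfl s1 s2))
  · by_cases s1 : x.val = o.val + 1 <;> by_cases s2 : y.val = x.val + 1 <;>
      by_cases s3 : l.val = y.val + 1
    · exact Or.inr (Or.inl ⟨by omega, _, hs⟩)
    · refine Or.inr (Or.inr (outer (k := o) (R := {t₁, t₂}) n3 s3 fun hcut => ?_))
      have r1 : finRotate m o = x := finRotate_eq_iff.2 (Or.inl s1)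
      have r2 : finRotate m x = y := finRotate_eq_iff.2 (Or.inl s2)
      refine isLeaf_pair (n := x.val) (n' := y.val) hcut ?_ hs hn ha ?_ fun t' ht' => ?_
      · rw [r1]
        ext w
        rw [Finset.mem_compl, Finset.mem_Icc, Finset.mem_insert, Finset.mem_singleton]
        omega
      · rw [r1, r2, finRotate_symm_eq_iff.2 (Or.inr ⟨ho, hl⟩), hU]
        ext w
        simp only [Finset.mem_insert, Finset.mem_singleton]
        tauto
      · have := midc n3 t' ht'
        omega
    -- The free vertices of the square are the last and the first one; in cyclic order they start
    -- with `l`.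
    · refine Or.inr (Or.inr (outer (k := l) (R := {t₁, t₂}) n2 s2 fun hcut => ?_))
      have r1 : finRotate m l = o := finRotate_eq_iff.2 (Or.inr ⟨ho, hl⟩)
      have r2 : finRotate m o = x := finRotate_eq_iff.2 (Or.inl s1)
      refine isLeaf_pair (n := x.val) (n' := y.val) hcut ?_ hs hn ha ?_ fun t' ht' => ?_
      · rw [r1]
        ext w
        rw [Finset.mem_compl, Finset.mem_Icc, Finset.mem_insert, Finset.mem_singleton]
        omega
      · rw [r1, r2, finRotate_symm_eq_iff.2 (Or.inl s3), hU]
        ext w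
        simp only [Finset.mem_insert, Finset.mem_singleton]
        tauto
      · have := midc n2 t' ht'
        omega
    · exact Or.inr (Or.inr (inner n2 n3 le_rfl s2 s3))
    · refine Or.inr (Or.inr (outer (k := y) (R := {t₁, t₂}) n1 s1 fun hcut => ?_))
      have r1 : finRotate m y = l := finRotate_eq_iff.2 (Or.inl s3)
      have r2 : finRotate m l = o := finRotate_eq_iff.2 (Or.inr ⟨ho, hl⟩)
      refine isLeaf_pair (n := x.val) (n' := y.val) hcut ?_ hs hn ha ?_ fun t' ht' => ?_
      · rw [r1]
        ext w
        rw [Finset.mem_compl, Finset.mem_Icc, Finset.mem_insert, Finset.mem_singleton]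
        omega
      · rw [r1, r2, finRotate_symm_eq_iff.2 (Or.inl s2), hU]
        ext w
        simp only [Finset.mem_insert, Finset.mem_singleton]
        tauto
      · have := midc n1 t' ht'
        omega
    · exact Or.inr (Or.inr (inner n1 n3 hxy.le s1 s3))
    · exact Or.inr (Or.inr (inner n1 n2 le_rfl s1 s2))
    · exact Or.inr (Or.inr (inner n1 n2 le_rfl s1 s2))

end Triangulation

end LabelledPolygon

/-! ### Removing one leaf or two -/

namespace LabelledPolygon

namespace Triangulation

variable {m : ℕ} {T : Triangulation m} {a : T.Labelling} {P : Finset (Finset T.Triangle)}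

theorem Edge.subset_Icc_of_not_disjoint {i j : Fin m} (h : T.Edge i j) {t : T.Triangle}
    (ht : ¬ Disjoint t.1 (Finset.Ioo i j)) : t.1 ⊆ Finset.Icc i j := by
  obtain ⟨w, hw, hw'⟩ := Finset.not_disjoint_iff.1 ht
  intro v hv
  have a1 := h.not_cross_triangle t hw hv
  have a2 := h.not_cross_triangle' t hv hw
  rw [Finset.mem_Ioo] at hw'
  rw [Finset.mem_Icc]
  omega

theorem card_pair_finRotate (T : Triangulation m) (k : Fin m) :
    ({k, finRotate m k} : Finset (Fin m)).card = 2 := by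
  refine Finset.card_pair fun h => ?_
  have h1 := finRotate_eq_iff.1 h.symm
  have h2 := T.two_le
  omega

theorem card_filter_notMem_and {R : Finset T.Triangle} {c : ℤ} (h : ∀ t ∈ R, a t ≠ c) :
    (Finset.univ.filter fun t => t ∉ R ∧ a t = c).card =
      (Finset.univ.filter fun t => a t = c).card := by
  congr 1
  ext t
  simp only [Finset.mem_filter, Finset.mem_univ, true_and, and_iff_right_iff_imp]
  exact fun ht htR => h t htR ht

theorem card_filter_notMem_and_add {R : Finset T.Triangle} {c : ℤ} (h : ∀ t ∈ R, a t = c) :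
    (Finset.univ.filter fun t => t ∉ R ∧ a t = c).card + R.card =
      (Finset.univ.filter fun t => a t = c).card := by
  rw [← Finset.card_union_of_disjoint]
  · congr 1
    ext t
    simp only [Finset.mem_union, Finset.mem_filter, Finset.mem_univ, true_and]
    have := h t
    tauto
  · refine Finset.disjoint_left.2 fun t ht => ?_
    exact (Finset.mem_filter.1 ht).2.1

theorem IsSquarePartition.disjoint_of_forall (hP : T.IsSquarePartition a P)
    {R : Finset T.Triangle} (h : ∀ t ∈ R, a t = 1 ∨ a t = -1) : ∀ s ∈ P, Disjoint s R := by
  refine fun s hs => Finset.disjoint_left.2 fun t ht htR => ?_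
  have h1 := hP.ne_of_mem hs ht
  have h2 := h t htR
  tauto

/-- Removal of an ear labelled `ε`, after which the labels are multiplied by `ε`. -/
theorem removalAdmissible_ear (hP : T.IsSquarePartition a P) {k : Fin m} {t : T.Triangle}
    (hcut : T.Cut {k}) (hR : ∀ t', t' ∈ ({t} : Finset T.Triangle) ↔ ¬ Disjoint t'.1 {k})
    {ε : ℤ} (hε : ε = 1 ∨ ε = -1) (ht : a t = ε)
    (heven : Even ((Finset.univ.filter fun t => a t = -ε).card + P.card)) :
    T.RemovalAdmissible a {t} {k} ε (m - 1) := by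
  obtain ⟨m', T', e, h⟩ := hcut.exists_isDeletion
  have hc := h.card_add
  rw [Finset.card_singleton] at hc
  obtain rfl : m' = m - 1 := by omega
  refine h.removalAdmissible hP hR (Q := P) subset_rfl ?_ (fun s hs hs' => absurd hs hs') hε ?_
  · refine hP.disjoint_of_forall fun t' ht' => ?_
    rw [Finset.mem_singleton.1 ht', ht]
    exact hε
  · rwa [card_filter_notMem_and]
    intro t' ht'
    rw [Finset.mem_singleton.1 ht']
    omega

/-- Negation turns the old labels `1` into the new labels `-1`, and one square is lost; hence the
parity condition. -/
theorem removalAdmissible_square (hP : T.IsSquarePartition a P) {k : Fin m}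
    {s : Finset T.Triangle} (hs : s ∈ P) (hcut : T.Cut {k, finRotate m k})
    (hR : ∀ t', t' ∈ s ↔ ¬ Disjoint t'.1 {k, finRotate m k})
    (heven : Even ((Finset.univ.filter fun t => a t = 1).card + (P.card - 1))) :
    T.RemovalAdmissible a s {k, finRotate m k} (-1) (m - 2) := by
  obtain ⟨m', T', e, h⟩ := hcut.exists_isDeletion
  have hc := h.card_add
  rw [T.card_pair_finRotate] at hc
  obtain rfl : m' = m - 2 := by omega
  refine h.removalAdmissible hP hR (Q := P.erase s) (Finset.erase_subset _ _) ?_ ?_ (Or.inr rfl) ?_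
  · intro s' hs'
    obtain ⟨hne, hs'⟩ := Finset.mem_erase.1 hs'
    exact hP.2.1 _ hs' _ hs hne
  · intro s' hs' hn
    rw [Finset.mem_erase, not_and_or, not_not] at hn
    rcases hn with rfl | hn
    · exact subset_rfl
    · exact absurd hs' hn
  · rw [Finset.card_erase_of_mem hs, neg_neg, card_filter_notMem_and]
    · exact heven
    · exact fun t ht => (hP.ne_of_mem hs ht).1

section

variable {i j k₁ k₂ : Fin m} {R₁ R₂ : Finset T.Triangle} {S : Finset (Fin m)}

theorem IsLeaf.disjoint (h₁ : T.IsLeaf a P k₁ R₁ S) (hij : T.Edge i j)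
    (h₂ : T.IsLeaf a P k₂ R₂ (Finset.Ioo i j)) (hd : Disjoint S (Finset.Icc i j)) :
    Disjoint R₁ R₂ := by
  refine Finset.disjoint_left.2 fun t ht₁ ht₂ => ?_
  have hsub := hij.subset_Icc_of_not_disjoint ((h₂.2.1 t).1 ht₂)
  exact (h₁.2.1 t).1 ht₁ (Finset.disjoint_of_subset_left hsub hd.symm)

/-- The vertex `k₂` is strictly between `i` and `j`, while `k₁` is outside the closed interval, so
`i` or `j` separates them. -/
theorem IsLeaf.one_lt_abs_sub (h₁ : T.IsLeaf a P k₁ R₁ S)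
    (h₂ : T.IsLeaf a P k₂ R₂ (Finset.Ioo i j)) (hd : Disjoint S (Finset.Icc i j)) :
    1 < |(k₁.val : ℤ) - (k₂.val : ℤ)| := by
  have hk₁ := Finset.disjoint_left.1 hd h₁.mem
  have hk₂ := h₂.mem
  rw [Finset.mem_Icc] at hk₁
  rw [Finset.mem_Ioo] at hk₂
  rw [lt_abs]
  omega

theorem IsLeaf.mem_union_iff (h₁ : T.IsLeaf a P k₁ R₁ S)
    (h₂ : T.IsLeaf a P k₂ R₂ (Finset.Ioo i j)) (t : T.Triangle) :
    t ∈ R₁ ∪ R₂ ↔ ¬ Disjoint t.1 (S ∪ Finset.Ioo i j) := by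
  rw [Finset.mem_union, h₁.2.1, h₂.2.1, Finset.disjoint_union_right, not_and_or]

theorem IsLeaf.exists_isDeletion_union (h₁ : T.IsLeaf a P k₁ R₁ S) (hij : T.Edge i j)
    (hd : Disjoint S (Finset.Icc i j)) :
    ∃ (m' : ℕ) (T' : Triangulation m') (e : Fin m' ↪o Fin m),
      T.IsDeletion (S ∪ Finset.Ioo i j) T' e ∧ m' + (S.card + (Finset.Ioo i j).card) = m := by
  obtain ⟨m', T', e, h⟩ := h₁.1.exists_isDeletion_union hij hd
  refine ⟨m', T', e, h, ?_⟩
  rw [← Finset.card_union_of_disjoint (Finset.disjoint_of_subset_right Finset.Ioo_subset_Icc_self hd)]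
  exact h.card_add

end

end Triangulation

end LabelledPolygon

/-! ### Parity argument on the two leaves -/

open LabelledPolygon Triangulation in
theorem mainTheorem10 {m : ℕ} (T : LabelledPolygon.Triangulation m) (a : T.Labelling) (ha : T.Admissible a)
    (P : Finset (Finset T.Triangle)) (hP : T.IsSquarePartition a P) :
    -- (0) small polygons
    (m < 4 ∧ (IsEmpty T.Triangle ∨ ∃ t : T.Triangle, (∀ t' : T.Triangle, t' = t) ∧ a t = 1)) ∨
    -- (1) remove a triangle labelled 1
    (∃ (k : Fin m) (t : T.Triangle), T.IsEarTriangle t k ∧ a t = 1 ∧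
      T.RemovalAdmissible a {t} {k} 1 (m - 1)) ∨
    -- (2) m odd: remove a square and negate
    (Odd m ∧ ∃ (k : Fin m) (c : ℤ), ∃ s ∈ P, T.IsBoundarySquare a s k c ∧
      T.RemovalAdmissible a s {k, finRotate m k} (-1) (m - 2)) ∨
    -- (3) m even: remove a triangle labelled -1 and negate
    (Even m ∧ ∃ (k : Fin m) (t : T.Triangle), T.IsEarTriangle t k ∧ a t = -1 ∧
      T.RemovalAdmissible a {t} {k} (-1) (m - 1)) ∨
    -- (4) remove two squares
    (∃ (j k : Fin m) (c d : ℤ), ∃ s ∈ P, ∃ s' ∈ P, s ≠ s' ∧ 1 < |(j.val : ℤ) - (k.val : ℤ)| ∧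
      T.IsBoundarySquare a s j c ∧ T.IsBoundarySquare a s' k d ∧
      T.RemovalAdmissible a (s ∪ s') {j, finRotate m j, k, finRotate m k} 1 (m - 4)) ∨
    -- (5) remove two triangles labelled -1
    (∃ (j k : Fin m) (t t' : T.Triangle), 1 < |(j.val : ℤ) - (k.val : ℤ)| ∧
      T.IsEarTriangle t j ∧ a t = -1 ∧ T.IsEarTriangle t' k ∧ a t' = -1 ∧
      T.RemovalAdmissible a {t, t'} {j, k} 1 (m - 2)) := by
  have hm := T.two_le
  have heven := ha.even hP
  have hcard := hP.card_eq
  have hT := card_triangle (T := T)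
  by_cases hm3 : m < 3
  · refine Or.inl ⟨by omega, Or.inl (Fintype.card_eq_zero_iff.1 (by omega))⟩
  rcases exists_two_leaves hP (by omega) with ⟨h3, t, ht⟩ | ⟨h4, hne⟩ |
    ⟨k₁, k₂, i, j, R₁, R₂, S, hl₁, hij, hl₂, hd⟩
  · refine Or.inl ⟨by omega, Or.inr ⟨t, fun t' => ?_, ht.resolve_right fun ht => ?_⟩⟩
    · exact (Fintype.card_le_one_iff.1 (by omega)) t' t
    -- A single triangle labelled `-1` would give the odd exponent `1`.
    · have : 0 < (Finset.univ.filter fun t => a t = -1).card :=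
        Finset.card_pos.2 ⟨t, by simp [ht]⟩
      rw [Nat.even_iff] at heven
      omega
  -- A single square also has the odd exponent `1`.
  · have := hne.card_pos
    rw [Nat.even_iff] at heven
    omega
  · have hR := hl₁.disjoint hij hl₂ hd
    have hk := hl₁.one_lt_abs_sub hl₂ hd
    have hmem := hl₁.mem_union_iff hl₂
    obtain ⟨m', T', e, hdel, hm'⟩ := hl₁.exists_isDeletion_union hij hd
    obtain ⟨hcut₁, hmem₁, hk₁⟩ := hl₁
    obtain ⟨hcut₂, hmem₂, hk₂⟩ := hl₂
    -- Once the interval is a variable, it can be replaced by the explicit vertex set of the second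
    -- leaf.
    generalize Finset.Ioo i j = S₂ at *
    -- the reductions that need one leaf only
    have ear_one : ∀ {k t}, T.Cut {k} →
        (∀ t', t' ∈ ({t} : Finset T.Triangle) ↔ ¬ Disjoint t'.1 {k}) → T.IsEarTriangle t k →
        a t = 1 → ∃ (k : Fin m) (t : T.Triangle), T.IsEarTriangle t k ∧ a t = 1 ∧
          T.RemovalAdmissible a {t} {k} 1 (m - 1) := fun hc hR he h1 =>
      ⟨_, _, he, h1, removalAdmissible_ear hP hc hR (Or.inl rfl) h1 heven⟩
    have ear_neg : ∀ {k t}, Even m → T.Cut {k} →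
        (∀ t', t' ∈ ({t} : Finset T.Triangle) ↔ ¬ Disjoint t'.1 {k}) → T.IsEarTriangle t k →
        a t = -1 → ∃ (k : Fin m) (t : T.Triangle), T.IsEarTriangle t k ∧ a t = -1 ∧
          T.RemovalAdmissible a {t} {k} (-1) (m - 1) := fun hm hc hR he h1 =>
      ⟨_, _, he, h1, removalAdmissible_ear hP hc hR (Or.inr rfl) h1 (by
        -- The number of labels `1` plus `P.card` is `m - 2` minus the even number in `heven`, so it
        -- has the parity of `m`.
        rw [neg_neg]
        rw [Nat.even_iff] at *
        omega)⟩
    have square_neg : ∀ {k c s}, Odd m → s ∈ P → T.Cut {k, finRotate m k} →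
        (∀ t', t' ∈ s ↔ ¬ Disjoint t'.1 {k, finRotate m k}) → T.IsBoundarySquare a s k c →
        ∃ (k : Fin m) (c : ℤ), ∃ s ∈ P, T.IsBoundarySquare a s k c ∧
          T.RemovalAdmissible a s {k, finRotate m k} (-1) (m - 2) := fun hm hs hc hR hb =>
      ⟨_, _, _, hs, hb, removalAdmissible_square hP hs hc hR (by
        -- Positivity makes the natural subtraction `P.card - 1` exact, so that it flips the parity.
        have := Finset.card_pos.2 ⟨_, hs⟩
        rw [Nat.even_iff] at *
        rw [Nat.odd_iff] at hm
        omega)⟩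
    rcases hk₁ with ⟨t₁, rfl, rfl, he₁, ha₁⟩ | ⟨c₁, hs₁, rfl, hb₁⟩
    · rcases ha₁ with ha₁ | ha₁
      · exact Or.inr (Or.inl (ear_one hcut₁ hmem₁ he₁ ha₁))
      rcases Nat.even_or_odd m with hpar | hpar
      · exact Or.inr (Or.inr (Or.inr (Or.inl ⟨hpar, ear_neg hpar hcut₁ hmem₁ he₁ ha₁⟩)))
      -- With `m` odd and the first leaf labelled `-1`, only a second leaf labelled `-1` escapes the
      -- reductions by a single leaf.
      rcases hk₂ with ⟨t₂, rfl, rfl, he₂, ha₂⟩ | ⟨c₂, hs₂, rfl, hb₂⟩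
      · rcases ha₂ with ha₂ | ha₂
        · exact Or.inr (Or.inl (ear_one hcut₂ hmem₂ he₂ ha₂))
        refine Or.inr (Or.inr (Or.inr (Or.inr (Or.inr
          ⟨k₁, k₂, t₁, t₂, hk, he₁, ha₁, he₂, ha₂, ?_⟩))))
        rw [Finset.card_singleton, Finset.card_singleton] at hm'
        obtain rfl : m' = m - 2 := by omega
        have hne : t₁ ≠ t₂ := by simpa using hR
        have hall : ∀ t ∈ ({t₁, t₂} : Finset T.Triangle), a t = -1 := by
          simp [ha₁, ha₂]
        refine hdel.removalAdmissible hP hmem (Q := P) subset_rfl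
          (hP.disjoint_of_forall fun t ht => Or.inr (hall t ht))
          (fun s hs hs' => absurd hs hs') (Or.inl rfl) ?_
        have := card_filter_notMem_and_add hall
        rw [Finset.card_pair hne] at this
        rw [Nat.even_iff] at *
        change (Finset.card (Finset.univ.filter fun t =>
          t ∉ ({t₁, t₂} : Finset T.Triangle) ∧ a t = -1) + P.card) % 2 = 0
        omega
      · exact Or.inr (Or.inr (Or.inl ⟨hpar, square_neg hpar hs₂ hcut₂ hmem₂ hb₂⟩))
    · rcases Nat.even_or_odd m with hpar | hpar
      swap
      · exact Or.inr (Or.inr (Or.inl ⟨hpar, square_neg hpar hs₁ hcut₁ hmem₁ hb₁⟩))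
      -- With `m` even and the first leaf a square, only a second square escapes the reductions by a
      -- single leaf.
      rcases hk₂ with ⟨t₂, rfl, rfl, he₂, ha₂⟩ | ⟨c₂, hs₂, rfl, hb₂⟩
      · rcases ha₂ with ha₂ | ha₂
        · exact Or.inr (Or.inl (ear_one hcut₂ hmem₂ he₂ ha₂))
        · exact Or.inr (Or.inr (Or.inr (Or.inl ⟨hpar, ear_neg hpar hcut₂ hmem₂ he₂ ha₂⟩)))
      have hne : R₁ ≠ R₂ := by
        rintro rfl
        obtain ⟨t, t', rfl, -⟩ := hb₁
        exact Finset.disjoint_left.1 hR (Finset.mem_insert_self t _) (Finset.mem_insert_self t _)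
      refine Or.inr (Or.inr (Or.inr (Or.inr (Or.inl
        ⟨k₁, k₂, c₁, c₂, R₁, hs₁, R₂, hs₂, hne, hk, hb₁, hb₂, ?_⟩))))
      rw [T.card_pair_finRotate, T.card_pair_finRotate] at hm'
      obtain rfl : m' = m - 4 := by omega
      have hS : ({k₁, finRotate m k₁} ∪ {k₂, finRotate m k₂} : Finset (Fin m)) =
          {k₁, finRotate m k₁, k₂, finRotate m k₂} := by
        rw [Finset.insert_union, Finset.singleton_union]
      rw [hS] at hdel hmem
      have hs₂' : R₂ ∈ P.erase R₁ := Finset.mem_erase.2 ⟨hne.symm, hs₂⟩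
      refine hdel.removalAdmissible hP hmem (Q := (P.erase R₁).erase R₂)
        ((Finset.erase_subset _ _).trans (Finset.erase_subset _ _)) ?_ ?_ (Or.inl rfl) ?_
      · intro s hs
        obtain ⟨h2, hs⟩ := Finset.mem_erase.1 hs
        obtain ⟨h1, hs⟩ := Finset.mem_erase.1 hs
        exact Finset.disjoint_union_right.2 ⟨hP.2.1 _ hs _ hs₁ h1, hP.2.1 _ hs _ hs₂ h2⟩
      · intro s hs hn
        by_cases h2 : s = R₂
        · subst h2
          exact Finset.subset_union_right
        by_cases h1 : s = R₁
        · subst h1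
          exact Finset.subset_union_left
        exact absurd (Finset.mem_erase.2 ⟨h2, Finset.mem_erase.2 ⟨h1, hs⟩⟩) hn
      · have h1 := Finset.card_erase_of_mem hs₁
        have h2 := Finset.card_erase_of_mem hs₂'
        have h3 := Finset.card_pos.2 ⟨_, hs₂'⟩
        rw [card_filter_notMem_and]
        · rw [Nat.even_iff] at *
          omega
        · intro t ht
          rcases Finset.mem_union.1 ht with ht | ht
          · exact (hP.ne_of_mem hs₁ ht).2
          · exact (hP.ne_of_mem hs₂ ht).2
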